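/- For integers $k\ge 1$ and $n\ge 0$ let $G_k(n)$ be the $k\times n$ grid graph, with vertices $v_{ij}$ ($1\le i\le k$, $1\le j\le n$) and with $v_{ij}$, $v_{i'j'}$ adjacent exactly when $|i-i'|+|j-j'|=1$. Let $s(k,n)$ be the number of spanning trees of $G_k(n)$ (so $s(k,0)=0$, the empty graph not being a tree), and let $F_k(t)=\sum_{n=0}^{\infty}s(k,n)\,t^n$, a formal power series over $\mathbb{Q}$. Then $F_k(t)=N_k(t)/D_k(t)$ for $k=1,\dots,7$ (the right-hand side being expanded as a power series at $t=0$; every $D_k(0)=1$), where $$\begin{aligned} N_1={}& t,\\ D_1={}& -t + 1. \end{aligned}$$ $$\begin{aligned} N_2={}& t,\\ D_2={}& t^{2} - 4\,t + 1. \end{aligned}$$ $$\begin{aligned} N_3={}& -t^{3} + t,\\ D_3={}& t^{4} - 15\,t^{3} + 32\,t^{2} - 15\,t + 1. \end{aligned}$$ $$\begin{aligned} N_4={}& t^{7} - 49\,t^{5} + 112\,t^{4} - 49\,t^{3} + t,\\ D_4={}& t^{8} - 56\,t^{7} + 672\,t^{6} - 2632\,t^{5} + 4094\,t^{4} - 2632\,t^{3}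 + 672\,t^{2} - 56\,t + 1. \end{aligned}$$ $$\begin{aligned} N_5={}& -t^{15} + 1440\,t^{13} - 26752\,t^{12} + 185889\,t^{11} - 574750\,t^{10} + 708928\,t^{9}\\ & - 708928\,t^{7} + 574750\,t^{6} - 185889\,t^{5} + 26752\,t^{4} - 1440\,t^{3} + t,\\ D_5={}& t^{16} - 209\,t^{15} + 11936\,t^{14} - 274208\,t^{13} + 3112032\,t^{12} - 19456019\,t^{11}\\ & + 70651107\,t^{10} - 152325888\,t^{9} + 196664896\,t^{8} - 152325888\,t^{7} + 70651107\,t^{6}\\ & - 19456019\,t^{5} + 3112032\,t^{4} - 274208\,t^{3} + 11936\,t^{2} - 209\,t + 1. \end{aligned}$$ $$\begin{aligned} N_6={}& t^{31} - 33359\,t^{29} + 3642600\,t^{28} - 173371343\,t^{27} + 4540320720\,t^{26}\\ & - 70164186331\,t^{25} + 634164906960\,t^{24} - 2844883304348\,t^{23} - 1842793012320\,t^{22}\\ & + 104844096982372\,t^{21} - 678752492380560\,t^{20} + 2471590551535210\,t^{19}\\ & - 5926092273213840\,t^{18} + 9869538714631398\,t^{17} - 11674018886109840\,t^{16}\\ &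 + 9869538714631398\,t^{15} - 5926092273213840\,t^{14} + 2471590551535210\,t^{13}\\ & - 678752492380560\,t^{12} + 104844096982372\,t^{11} - 1842793012320\,t^{10} - 2844883304348\,t^{9}\\ & + 634164906960\,t^{8} - 70164186331\,t^{7} + 4540320720\,t^{6} - 173371343\,t^{5} + 3642600\,t^{4}\\ & - 33359\,t^{3} + t,\\ D_6={}& t^{32} - 780\,t^{31} + 194881\,t^{30} - 22377420\,t^{29} + 1419219792\,t^{28} - 55284715980\,t^{27}\\ & + 1410775106597\,t^{26} - 24574215822780\,t^{25} + 300429297446885\,t^{24}\\ & - 2629946465331120\,t^{23} + 16741727755133760\,t^{22} - 78475174345180080\,t^{21}\\ & + 273689714665707178\,t^{20} - 716370537293731320\,t^{19} + 1417056251105102122\,t^{18}\\ & - 2129255507292156360\,t^{17} + 2437932520099475424\,t^{16} - 2129255507292156360\,t^{15}\\ & + 1417056251105102122\,t^{14} - 716370537293731320\,t^{13} + 273689714665707178\,t^{12}\\ & - 78475174345180080\,t^{11} + 16741727755133760\,t^{10} - 2629946465331120\,t^{9}\\ & + 300429297446885\,t^{8} - 24574215822780\,t^{7} + 1410775106597\,t^{6}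 - 55284715980\,t^{5}\\ & + 1419219792\,t^{4} - 22377420\,t^{3} + 194881\,t^{2} - 780\,t + 1. \end{aligned}$$ $$\begin{aligned} N_7={}& -t^{47} - 142\,t^{46} + 661245\,t^{45} - 279917500\,t^{44} + 53184503243\,t^{43}\\ & - 5570891154842\,t^{42} + 341638600598298\,t^{41} - 11886702497030032\,t^{40}\\ & + 164458937576610742\,t^{39} + 4371158470492451828\,t^{38} - 288737344956855301342\,t^{37}\\ & + 7736513993329973661368\,t^{36} - 131582338768322853956994\,t^{35}\\ & + 1573202877300834187134466\,t^{34} - 13805721749199518460916737\,t^{33}\\ & + 90975567796174070740787232\,t^{32} - 455915282590547643587452175\,t^{31}\\ & + 1747901867578637315747826286\,t^{30} - 5126323837327170557921412877\,t^{29}\\ & + 11416779122947828869806142972\,t^{28} - 18924703166237080216745900796\,t^{27}\\ & + 22194247945745188489023284104\,t^{26} - 15563815847174688069871470516\,t^{25}\\ & + 15563815847174688069871470516\,t^{23} - 22194247945745188489023284104\,t^{22}\\ & + 18924703166237080216745900796\,t^{21} - 11416779122947828869806142972\,t^{20}\\ & + 5126323837327170557921412877\,t^{19} - 1747901867578637315747826286\,t^{18}\\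 & + 455915282590547643587452175\,t^{17} - 90975567796174070740787232\,t^{16}\\ & + 13805721749199518460916737\,t^{15} - 1573202877300834187134466\,t^{14}\\ & + 131582338768322853956994\,t^{13} - 7736513993329973661368\,t^{12} + 288737344956855301342\,t^{11}\\ & - 4371158470492451828\,t^{10} - 164458937576610742\,t^{9} + 11886702497030032\,t^{8}\\ & - 341638600598298\,t^{7} + 5570891154842\,t^{6} - 53184503243\,t^{5} + 279917500\,t^{4}\\ & - 661245\,t^{3} + 142\,t^{2} + t,\\ D_7={}& t^{48} - 2769\,t^{47} + 2630641\,t^{46} - 1195782497\,t^{45} + 305993127089\,t^{44}\\ & - 48551559344145\,t^{43} + 5083730101530753\,t^{42} - 366971376492201338\,t^{41}\\ & + 18871718211768417242\,t^{40} - 709234610141846974874\,t^{39} + 19874722637854592209338\,t^{38}\\ & - 422023241997789381263002\,t^{37} + 6880098547452856483997402\,t^{36}\\ & - 87057778313447181201990522\,t^{35} + 862879164715733847737203343\,t^{34}\\ & - 6750900711491569851736413311\,t^{33} + 41958615314622858303912597215\,t^{32}\\ & - 208258356862493902206466194607\,t^{31} + 828959040281722890327985220255\,t^{30}\\ & - 2654944041424536277948746010303\,t^{29}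 + 6859440538554030239641036025103\,t^{28}\\ & - 14324708604336971207868317957868\,t^{27} + 24214587194571650834572683444012\,t^{26}\\ & - 33166490975387358866518005011884\,t^{25} + 36830850383375837481096026357868\,t^{24}\\ & - 33166490975387358866518005011884\,t^{23} + 24214587194571650834572683444012\,t^{22}\\ & - 14324708604336971207868317957868\,t^{21} + 6859440538554030239641036025103\,t^{20}\\ & - 2654944041424536277948746010303\,t^{19} + 828959040281722890327985220255\,t^{18}\\ & - 208258356862493902206466194607\,t^{17} + 41958615314622858303912597215\,t^{16}\\ & - 6750900711491569851736413311\,t^{15} + 862879164715733847737203343\,t^{14}\\ & - 87057778313447181201990522\,t^{13} + 6880098547452856483997402\,t^{12}\\ & - 422023241997789381263002\,t^{11} + 19874722637854592209338\,t^{10} - 709234610141846974874\,t^{9}\\ & + 18871718211768417242\,t^{8} - 366971376492201338\,t^{7} + 5083730101530753\,t^{6}\\ & - 48551559344145\,t^{5} + 305993127089\,t^{4} - 1195782497\,t^{3} + 2630641\,t^{2} - 2769\,t + 1. \end{aligned}$$ In the case $k=7$ the fraction $N_7/D_7$ is in lowest terms ($N_7$ and $D_7$ are coprime in $\mathbb{Q}[t]$),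 and its denominator $D_7$ has degree $48$. -/

import Mathlib

open Polynomial
open scoped PowerSeries

/-- The `k × n` grid graph `G_k(n)`: the vertices are the pairs `(i, j)` with `i` among `k` values and
`j` among `n` values, and `(i, j)`, `(i', j')` are adjacent exactly when `|i - i'| + |j - j'| = 1`. -/
def gridGraph (k n : ℕ) : SimpleGraph (Fin k × Fin n) where
  Adj p q := |(p.1 : ℤ) - (q.1 : ℤ)| + |(p.2 : ℤ) - (q.2 : ℤ)| = 1
  symm := ⟨fun p q h => by
    rw [abs_sub_comm (q.1 : ℤ), abs_sub_comm (q.2 : ℤ)]; exact h⟩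
  loopless := ⟨fun p h => by simp at h⟩

/-- The number `s(k, n)` of spanning trees of the `k × n` grid graph: trees on the same vertex set all
of whose edges are edges of the grid graph. A tree is nonempty, so `s(k, 0) = 0`. -/
noncomputable def numSpanningTrees (k n : ℕ) : ℕ :=
  Nat.card {T : SimpleGraph (Fin k × Fin n) // T ≤ gridGraph k n ∧ T.IsTree}

/-- The formal power series `F_k(t) = ∑ s(k, n) tⁿ`, over all `n ≥ 0`. -/
noncomputable def gridGF (k : ℕ) : ℚ⟦X⟧ :=
  PowerSeries.mk fun n => (numSpanningTrees k n : ℚ)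

/-- The power series expansion at `0` of the rational function `N / D`; it is used only for `D` with
constant coefficient `1`, where `D` is invertible as a power series. -/
noncomputable def ratSeries (N D : ℚ[X]) : ℚ⟦X⟧ :=
  (N : ℚ⟦X⟧) * (D : ℚ⟦X⟧)⁻¹

/-- The numerator of `F_1`. -/
noncomputable def gridNum1 : ℚ[X] :=
  X

/-- The denominator of `F_1`. -/
noncomputable def gridDen1 : ℚ[X] :=
  -X + 1

/-- The numerator of `F_2`. -/
noncomputable def gridNum2 : ℚ[X] :=
  X

/-- The denominator of `F_2`. -/
noncomputable def gridDen2 : ℚ[X] :=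
  X ^ 2 - 4 * X + 1

/-- The numerator of `F_3`. -/
noncomputable def gridNum3 : ℚ[X] :=
  -X ^ 3 + X

/-- The denominator of `F_3`. -/
noncomputable def gridDen3 : ℚ[X] :=
  X ^ 4 - 15 * X ^ 3 + 32 * X ^ 2 - 15 * X + 1

/-- The numerator of `F_4`. -/
noncomputable def gridNum4 : ℚ[X] :=
  X ^ 7 - 49 * X ^ 5 + 112 * X ^ 4 - 49 * X ^ 3 + X

/-- The denominator of `F_4`. -/
noncomputable def gridDen4 : ℚ[X] :=
  X ^ 8 - 56 * X ^ 7 + 672 * X ^ 6 - 2632 * X ^ 5 + 4094 * X ^ 4 - 2632 * X ^ 3 + 672 * X ^ 2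
  - 56 * X + 1

/-- The numerator of `F_5`. -/
noncomputable def gridNum5 : ℚ[X] :=
  -X ^ 15 + 1440 * X ^ 13 - 26752 * X ^ 12 + 185889 * X ^ 11 - 574750 * X ^ 10 + 708928 * X ^ 9
  - 708928 * X ^ 7 + 574750 * X ^ 6 - 185889 * X ^ 5 + 26752 * X ^ 4 - 1440 * X ^ 3 + X

/-- The denominator of `F_5`. -/
noncomputable def gridDen5 : ℚ[X] :=
  X ^ 16 - 209 * X ^ 15 + 11936 * X ^ 14 - 274208 * X ^ 13 + 3112032 * X ^ 12 - 19456019 * X ^ 11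
  + 70651107 * X ^ 10 - 152325888 * X ^ 9 + 196664896 * X ^ 8 - 152325888 * X ^ 7
  + 70651107 * X ^ 6 - 19456019 * X ^ 5 + 3112032 * X ^ 4 - 274208 * X ^ 3 + 11936 * X ^ 2
  - 209 * X + 1

/-- The numerator of `F_6`. -/
noncomputable def gridNum6 : ℚ[X] :=
  X ^ 31 - 33359 * X ^ 29 + 3642600 * X ^ 28 - 173371343 * X ^ 27 + 4540320720 * X ^ 26
  - 70164186331 * X ^ 25 + 634164906960 * X ^ 24 - 2844883304348 * X ^ 23
  - 1842793012320 * X ^ 22 + 104844096982372 * X ^ 21 - 678752492380560 * X ^ 20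
  + 2471590551535210 * X ^ 19 - 5926092273213840 * X ^ 18 + 9869538714631398 * X ^ 17
  - 11674018886109840 * X ^ 16 + 9869538714631398 * X ^ 15 - 5926092273213840 * X ^ 14
  + 2471590551535210 * X ^ 13 - 678752492380560 * X ^ 12 + 104844096982372 * X ^ 11
  - 1842793012320 * X ^ 10 - 2844883304348 * X ^ 9 + 634164906960 * X ^ 8 - 70164186331 * X ^ 7
  + 4540320720 * X ^ 6 - 173371343 * X ^ 5 + 3642600 * X ^ 4 - 33359 * X ^ 3 + X

/-- The denominator of `F_6`. -/
noncomputable def gridDen6 : ℚ[X] :=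
  X ^ 32 - 780 * X ^ 31 + 194881 * X ^ 30 - 22377420 * X ^ 29 + 1419219792 * X ^ 28
  - 55284715980 * X ^ 27 + 1410775106597 * X ^ 26 - 24574215822780 * X ^ 25
  + 300429297446885 * X ^ 24 - 2629946465331120 * X ^ 23 + 16741727755133760 * X ^ 22
  - 78475174345180080 * X ^ 21 + 273689714665707178 * X ^ 20 - 716370537293731320 * X ^ 19
  + 1417056251105102122 * X ^ 18 - 2129255507292156360 * X ^ 17 + 2437932520099475424 * X ^ 16
  - 2129255507292156360 * X ^ 15 + 1417056251105102122 * X ^ 14 - 716370537293731320 * X ^ 13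
  + 273689714665707178 * X ^ 12 - 78475174345180080 * X ^ 11 + 16741727755133760 * X ^ 10
  - 2629946465331120 * X ^ 9 + 300429297446885 * X ^ 8 - 24574215822780 * X ^ 7
  + 1410775106597 * X ^ 6 - 55284715980 * X ^ 5 + 1419219792 * X ^ 4 - 22377420 * X ^ 3
  + 194881 * X ^ 2 - 780 * X + 1

/-- The numerator of `F_7`. -/
noncomputable def gridNum7 : ℚ[X] :=
  -X ^ 47 - 142 * X ^ 46 + 661245 * X ^ 45 - 279917500 * X ^ 44 + 53184503243 * X ^ 43
  - 5570891154842 * X ^ 42 + 341638600598298 * X ^ 41 - 11886702497030032 * X ^ 40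
  + 164458937576610742 * X ^ 39 + 4371158470492451828 * X ^ 38 - 288737344956855301342 * X ^ 37
  + 7736513993329973661368 * X ^ 36 - 131582338768322853956994 * X ^ 35
  + 1573202877300834187134466 * X ^ 34 - 13805721749199518460916737 * X ^ 33
  + 90975567796174070740787232 * X ^ 32 - 455915282590547643587452175 * X ^ 31
  + 1747901867578637315747826286 * X ^ 30 - 5126323837327170557921412877 * X ^ 29
  + 11416779122947828869806142972 * X ^ 28 - 18924703166237080216745900796 * X ^ 27
  + 22194247945745188489023284104 * X ^ 26 - 15563815847174688069871470516 * X ^ 25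
  + 15563815847174688069871470516 * X ^ 23 - 22194247945745188489023284104 * X ^ 22
  + 18924703166237080216745900796 * X ^ 21 - 11416779122947828869806142972 * X ^ 20
  + 5126323837327170557921412877 * X ^ 19 - 1747901867578637315747826286 * X ^ 18
  + 455915282590547643587452175 * X ^ 17 - 90975567796174070740787232 * X ^ 16
  + 13805721749199518460916737 * X ^ 15 - 1573202877300834187134466 * X ^ 14
  + 131582338768322853956994 * X ^ 13 - 7736513993329973661368 * X ^ 12
  + 288737344956855301342 * X ^ 11 - 4371158470492451828 * X ^ 10 - 164458937576610742 * X ^ 9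
  + 11886702497030032 * X ^ 8 - 341638600598298 * X ^ 7 + 5570891154842 * X ^ 6
  - 53184503243 * X ^ 5 + 279917500 * X ^ 4 - 661245 * X ^ 3 + 142 * X ^ 2 + X

/-- The denominator of `F_7`. -/
noncomputable def gridDen7 : ℚ[X] :=
  X ^ 48 - 2769 * X ^ 47 + 2630641 * X ^ 46 - 1195782497 * X ^ 45 + 305993127089 * X ^ 44
  - 48551559344145 * X ^ 43 + 5083730101530753 * X ^ 42 - 366971376492201338 * X ^ 41
  + 18871718211768417242 * X ^ 40 - 709234610141846974874 * X ^ 39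
  + 19874722637854592209338 * X ^ 38 - 422023241997789381263002 * X ^ 37
  + 6880098547452856483997402 * X ^ 36 - 87057778313447181201990522 * X ^ 35
  + 862879164715733847737203343 * X ^ 34 - 6750900711491569851736413311 * X ^ 33
  + 41958615314622858303912597215 * X ^ 32 - 208258356862493902206466194607 * X ^ 31
  + 828959040281722890327985220255 * X ^ 30 - 2654944041424536277948746010303 * X ^ 29
  + 6859440538554030239641036025103 * X ^ 28 - 14324708604336971207868317957868 * X ^ 27
  + 24214587194571650834572683444012 * X ^ 26 - 33166490975387358866518005011884 * X ^ 25
  + 36830850383375837481096026357868 * X ^ 24 - 33166490975387358866518005011884 * X ^ 23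
  + 24214587194571650834572683444012 * X ^ 22 - 14324708604336971207868317957868 * X ^ 21
  + 6859440538554030239641036025103 * X ^ 20 - 2654944041424536277948746010303 * X ^ 19
  + 828959040281722890327985220255 * X ^ 18 - 208258356862493902206466194607 * X ^ 17
  + 41958615314622858303912597215 * X ^ 16 - 6750900711491569851736413311 * X ^ 15
  + 862879164715733847737203343 * X ^ 14 - 87057778313447181201990522 * X ^ 13
  + 6880098547452856483997402 * X ^ 12 - 422023241997789381263002 * X ^ 11
  + 19874722637854592209338 * X ^ 10 - 709234610141846974874 * X ^ 9
  + 18871718211768417242 * X ^ 8 - 366971376492201338 * X ^ 7 + 5083730101530753 * X ^ 6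
  - 48551559344145 * X ^ 5 + 305993127089 * X ^ 4 - 1195782497 * X ^ 3 + 2630641 * X ^ 2
  - 2769 * X + 1

/-! By Kirchhoff's theorem (`MatrixTree.card_spanningTrees`) the number of spanning trees is the
determinant of the Laplacian with one row replaced by a unit vector. The rows and columns of the
grid Laplacian sum to zero, so adding `u uᵀ`, with `u` the indicator of the first column of `k`
vertices, gives a matrix of determinant `k ^ 2 * s(k, n)` (`det_add_vecMulVec_of_sum_zero`).

This grounded Laplacian is block tridiagonal. Its blocks are polynomials in the path Laplacian `x =
pathLap k` and the all-ones matrix `J`, which commute because `x * J = J * x = 0`. The tridiagonal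
determinant is therefore evaluated over a commutative ring, giving `x * U n x + J` with `U = chebU`,
and a further determinant yields `k ^ 2 * s(k, n)` (`sq_mul_numSpanningTrees`). On constants `x` is
`0` and `J` is `k`. On the edge differences `J` vanishes and `x` acts by a matrix of determinant
`k`. All powers of `k` cancel, and `s(k, n)` is the determinant of `U n` at that matrix. The
reflection of the column splits it into two blocks of size at most three
(`numSpanningTrees_eq_mul`).

By Cayley-Hamilton, `U n` of a small block is a combination of few powers of it, and its determinant
is a norm form satisfying an explicit recurrence. A proposed recurrence for the product of the two
factors need only be checked on a finite rectangle of index pairs (`IsRec.mul`), and a recurrence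
with initial values fixes the rational generating function (`gridGF_eq_ratSeries`). For `k = 7`,
coprimality follows from a Bézout identity modulo `3`: a common root would be an algebraic integer,
and `-1/3` would be one too. -/

/-! ### The matrix-tree theorem -/

namespace MatrixTree

open Finset Matrix

variable {V : Type*}

/-- Every orbit of `f` reaches `r`. -/
def Reaches (f : V → V) (r : V) : Prop := ∀ v, ∃ n, f^[n] v = r

/-- A height function certifies that all orbits reach the root. -/
lemma Reaches.exists_height {f : V → V} {r : V} (h : Reaches f r) :
    ∃ d : V → ℕ, ∀ v, v ≠ r → d v = d (f v) + 1 := by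
  classical
  refine ⟨fun v => Nat.find (h v), fun v hv => ?_⟩
  refine (Nat.find_eq_iff _).2 ⟨?_, ?_⟩
  · rw [Function.iterate_succ_apply]; exact Nat.find_spec (h (f v))
  · intro n hn
    cases n with
    | zero => simpa using hv
    | succ n =>
      rw [Function.iterate_succ_apply]
      exact Nat.find_min (h (f v)) (Nat.lt_of_succ_lt_succ hn)

lemma reaches_of_height {f : V → V} {r : V} (d : V → ℕ) (hd : ∀ v, v ≠ r → d (f v) < d v) :
    Reaches f r := by
  intro v
  induction hn : d v using Nat.strong_induction_on generalizing v with
  | _ n ih =>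
    by_cases hv : v = r
    · exact ⟨0, hv⟩
    · obtain ⟨m, hm⟩ := ih _ (hn ▸ hd v hv) (f v) rfl
      exact ⟨m + 1, by rwa [Function.iterate_succ_apply]⟩

/-- Induction on the height for `f`. If `g` reversed the edge from `v` to `f v`, then at the lower
vertex `f v` the two maps would already agree, so `f` would send `f v` back up to `v`. This makes an
orientation of a tree towards its root unique. -/
lemma parentMap_unique {r : V} {f g : V → V} (hf : f r = r) (hg : g r = r) (hfr : Reaches f r)
    (h : ∀ v, v ≠ r → g v = f v ∨ g (f v) = v) : g = f := by
  obtain ⟨d, hd⟩ := hfr.exists_height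
  ext v
  induction hn : d v using Nat.strong_induction_on generalizing v with
  | _ n ih =>
    by_cases hv : v = r
    · rw [hv, hf, hg]
    · refine (h v hv).resolve_right fun hgv => ?_
      have h1 := hd v hv
      by_cases hw : f v = r
      · rw [hw, hg] at hgv
        exact hv hgv.symm
      · have h2 := hd _ hw
        have h3 := ih (d (f v)) (by omega) (f v) rfl
        rw [← h3, hgv] at h2
        omega

lemma fromRel_connected {r : V} {f : V → V} (hf : ∀ v, v ≠ r → f v ≠ v) (h : Reaches f r) :
    (SimpleGraph.fromRel fun v w => f v = w).Connected := by
  have key : ∀ v, (SimpleGraph.fromRel fun v w => f v = w).Reachable v r := by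
    obtain ⟨d, hd⟩ := h.exists_height
    intro v
    induction hn : d v using Nat.strong_induction_on generalizing v with
    | _ n ih =>
      by_cases hv : v = r
      · rw [hv]
      · have h1 := hd v hv
        refine SimpleGraph.Reachable.trans (SimpleGraph.Adj.reachable ?_)
          (ih (d (f v)) (by omega) (f v) rfl)
        rw [SimpleGraph.fromRel_adj]
        exact ⟨(hf v hv).symm, Or.inl rfl⟩
  have : Nonempty V := ⟨r⟩
  exact ⟨fun u v => (key u).trans (key v).symm⟩

/-- The parent of `v` is the second vertex of a shortest walk to `r`; the distance to `r` then
serves as a decreasing height. -/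
lemma exists_parentMap {T : SimpleGraph V} (hT : T.Connected) (r : V) :
    ∃ f : V → V, f r = r ∧ (∀ v, v ≠ r → T.Adj v (f v)) ∧ Reaches f r := by
  classical
  have h : ∀ v, v ≠ r → ∃ w, T.Adj v w ∧ T.dist w r < T.dist v r := by
    intro v hv
    obtain ⟨p, hp⟩ := hT.exists_walk_length_eq_dist v r
    cases p with
    | nil => exact absurd rfl hv
    | cons hadj q =>
      refine ⟨_, hadj, ?_⟩
      have := SimpleGraph.dist_le q
      rw [SimpleGraph.Walk.length_cons] at hp
      omega
  choose g hg using h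
  refine ⟨fun v => if hv : v = r then r else g v hv, by simp, fun v hv => ?_, ?_⟩
  · simpa [hv] using (hg v hv).1
  · refine reaches_of_height (fun v => T.dist v r) fun v hv => ?_
    simpa [hv] using (hg v hv).2

variable [Fintype V]

/-- Both edge sets have one element fewer than the vertex set. -/
lemma eq_of_le_of_isTree {T T' : SimpleGraph V} (h : T ≤ T') (hT : T.IsTree) (hT' : T'.IsTree) :
    T = T' := by
  rw [SimpleGraph.isTree_iff_connected_and_card] at hT hT'
  rw [← SimpleGraph.edgeSet_inj]
  refine Set.eq_of_subset_of_ncard_le (SimpleGraph.edgeSet_mono h) ?_ (Set.toFinite _)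
  change Nat.card _ ≤ Nat.card _
  omega

variable [DecidableEq V]

/-- The identity minus the transition matrix of the self-map `f`, whose fixed points are treated as
absorbing. -/
def funMatrix (f : V → V) : Matrix V V ℤ :=
  fun v w => if w = v then 1 else if w = f v then -1 else 0

/-- Away from the diagonal, nonzero entries point to strictly smaller height. Grouping vertices by
height makes the matrix block triangular with identity diagonal blocks. -/
lemma det_funMatrix_of_reaches {f : V → V} {r : V} (hr : f r = r) (h : Reaches f r) :
    (funMatrix f).det = 1 := by
  obtain ⟨d, hd⟩ := h.exists_height
  have hne : ∀ v w, w ≠ v → w = f v → d w < d v := by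
    rintro v w hw rfl
    have : v ≠ r := by rintro rfl; exact hw hr
    have := hd v this
    omega
  have hB : BlockTriangular (funMatrix f) (fun v => OrderDual.toDual (d v)) := by
    intro v w hvw
    have hvw : d v < d w := hvw
    unfold funMatrix
    rw [if_neg (by rintro rfl; exact lt_irrefl _ hvw), if_neg]
    intro hw
    have := hne v w (by rintro rfl; exact lt_irrefl _ hvw) hw
    omega
  rw [hB.det]
  refine prod_eq_one fun a _ => ?_
  suffices (funMatrix f).toSquareBlock (fun v => OrderDual.toDual (d v)) a = 1 by rw [this, det_one]
  ext ⟨v, hv⟩ ⟨w, hw⟩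
  simp only [toSquareBlock_def, of_apply, funMatrix, one_apply, Subtype.mk.injEq]
  by_cases hvw : v = w
  · simp [hvw]
  · rw [if_neg (Ne.symm hvw), if_neg, if_neg hvw]
    intro hw'
    have h1 := hne v w (Ne.symm hvw) hw'
    have h2 : d v = d w := by
      have := hv.trans hw.symm
      exact this
    omega

lemma funMatrix_mulVec {f : V → V} {v : V} (hv : f v ≠ v) (x : V → ℤ) :
    (funMatrix f *ᵥ x) v = x v - x (f v) := by
  have h : ∀ w, funMatrix f v w * x w =
      (if w = v then x w else 0) - (if w = f v then x w else 0) := by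
    intro w
    unfold funMatrix
    by_cases h1 : w = v
    · have : v ≠ f v := Ne.symm hv
      simp [h1, this]
    · by_cases h2 : w = f v <;> simp [h1, h2, hv]
  simp [mulVec, dotProduct, h, sum_sub_distrib]

lemma det_funMatrix_of_not_reaches {f : V → V} {r : V} (hf : ∀ v, v ≠ r → f v ≠ v)
    (hr : f r = r) (h : ¬ Reaches f r) : (funMatrix f).det = 0 := by
  classical
  rw [← exists_mulVec_eq_zero_iff]
  obtain ⟨u, hu⟩ := not_forall.1 h
  -- The indicator of the vertices that never reach `r` is constant along `f` and vanishes at `r`,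
  -- so it is a nonzero kernel vector.
  refine ⟨fun v => if ∃ n, f^[n] v = r then 0 else 1, fun h0 => ?_, ?_⟩
  · have := congrFun h0 u
    simp [hu] at this
  · ext v
    by_cases hv : v = r
    · subst hv
      have hrow : ∀ w, funMatrix f v w = if w = v then 1 else 0 := by
        intro w
        unfold funMatrix
        rw [hr]
        split_ifs <;> rfl
      have : ∃ n, f^[n] v = v := ⟨0, rfl⟩
      simp only [mulVec, dotProduct, hrow, ite_mul, one_mul, zero_mul, sum_ite_eq', mem_univ,
        if_true, if_pos this, Pi.zero_apply]
    · rw [funMatrix_mulVec (hf v hv)]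
      have hiff : (∃ n, f^[n] (f v) = r) ↔ ∃ n, f^[n] v = r := by
        constructor
        · rintro ⟨n, hn⟩
          exact ⟨n + 1, by rwa [Function.iterate_succ_apply]⟩
        · rintro ⟨n, hn⟩
          cases n with
          | zero => exact absurd hn hv
          | succ n => exact ⟨n, by rwa [Function.iterate_succ_apply] at hn⟩
      simp [hiff]

variable (G : SimpleGraph V) [DecidableRel G.Adj]

/-- The self-maps sending each vertex other than the root `r` to a neighbour, and fixing `r`. -/
def parentMaps (r : V) : Finset (V → V) :=
  Fintype.piFinset fun v => if v = r then {r} else G.neighborFinset v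

variable {G} in
lemma mem_parentMaps {r : V} {f : V → V} :
    f ∈ parentMaps G r ↔ f r = r ∧ ∀ v, v ≠ r → G.Adj v (f v) := by
  simp only [parentMaps, Fintype.mem_piFinset]
  constructor
  · intro h
    refine ⟨by simpa using h r, fun v hv => by simpa [hv] using h v⟩
  · rintro ⟨h1, h2⟩ v
    by_cases hv : v = r
    · simp [hv, h1]
    · simpa [hv] using h2 v hv

/-- Each Laplacian row at `v` is the sum of `e_v - e_w` over the neighbours `w` of `v`. Multilinear
expansion chooses one neighbour per non-root vertex, that is, a parent map, and each choice
contributes `1` or `0` according to whether it reaches the root. -/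
lemma det_updateRow_lapMatrix (r : V) [DecidablePred fun f : V → V => Reaches f r] :
    ((G.lapMatrix ℤ).updateRow r (Pi.single r 1)).det =
      #{f ∈ parentMaps G r | Reaches f r} := by
  -- At the root the only choice is `w = r`; the test `x = v` comes first, so this summand is the
  -- unit vector.
  have hrows : (G.lapMatrix ℤ).updateRow r (Pi.single r 1) = fun v =>
      ∑ w ∈ (if v = r then {r} else G.neighborFinset v),
        (fun x => if x = v then (1 : ℤ) else if x = w then -1 else 0) := by
    ext v x
    by_cases hv : v = r
    · subst hv
      simp [Pi.single_apply]
      split_ifs <;> rfl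
    · rw [updateRow_ne hv, if_neg hv, Finset.sum_apply]
      by_cases hx : x = v
      · simp [hx, SimpleGraph.lapMatrix, SimpleGraph.degMatrix]
      · have hx' : v ≠ x := Ne.symm hx
        simp [hx, hx', SimpleGraph.lapMatrix, SimpleGraph.degMatrix, SimpleGraph.adjMatrix_apply,
          Finset.sum_ite_eq, neg_ite]
  rw [hrows]
  have := (detRowAlternating (n := V) (R := ℤ)).toMultilinearMap.map_sum_finset
    (fun v w => fun x => if x = v then (1 : ℤ) else if x = w then -1 else 0)
    (fun v => if v = r then {r} else G.neighborFinset v)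
  refine this.trans ?_
  rw [card_filter]
  push_cast
  refine sum_congr rfl fun f hf => ?_
  obtain ⟨hr, hadj⟩ := mem_parentMaps.1 hf
  change (funMatrix f).det = _
  split_ifs with h
  · exact det_funMatrix_of_reaches hr h
  · exact det_funMatrix_of_not_reaches (fun v hv => (hadj v hv).ne') hr h

/-- Every edge is `s(v, f v)` for some non-root `v`, so there are at most `|V| - 1` edges;
connectedness gives the opposite inequality. -/
lemma fromRel_isTree {r : V} {f : V → V} (hr : f r = r) (hf : ∀ v, v ≠ r → f v ≠ v)
    (h : Reaches f r) : (SimpleGraph.fromRel fun v w => f v = w).IsTree := by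
  rw [SimpleGraph.isTree_iff_connected_and_card]
  have hc := fromRel_connected hf h
  refine ⟨hc, le_antisymm ?_ hc.card_vert_le_card_edgeSet_add_one⟩
  have hsub : (SimpleGraph.fromRel fun v w => f v = w).edgeSet ⊆
      ((univ.erase r).image fun v => s(v, f v) : Finset (Sym2 V)) := by
    intro e
    induction e with
    | _ a b =>
      rw [SimpleGraph.mem_edgeSet, SimpleGraph.fromRel_adj]
      rintro ⟨hab, rfl | rfl⟩
      · simp only [coe_image, Set.mem_image]
        exact ⟨a, by simpa using fun h => hab (by rw [h, hr]), rfl⟩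
      · simp only [coe_image, Set.mem_image]
        exact ⟨b, by simpa using fun h => hab (by rw [h, hr]), Sym2.eq_swap⟩
  have h1 := Set.ncard_le_ncard hsub (Finset.finite_toSet _)
  rw [Set.ncard_coe_finset] at h1
  have h2 : #((univ.erase r).image fun v => s(v, f v)) ≤ #(univ.erase r) := card_image_le
  rw [card_erase_of_mem (mem_univ r), card_univ] at h2
  have h3 : 0 < Fintype.card V := Fintype.card_pos_iff.2 ⟨r⟩
  rw [Nat.card_eq_fintype_card (α := V)]
  have h4 : Nat.card (SimpleGraph.fromRel fun v w => f v = w).edgeSet =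
    (SimpleGraph.fromRel fun v w => f v = w).edgeSet.ncard := rfl
  omega

/-- **Kirchhoff's matrix-tree theorem**. -/
theorem card_spanningTrees (r : V) :
    (Nat.card {T : SimpleGraph V // T ≤ G ∧ T.IsTree} : ℤ) =
      ((G.lapMatrix ℤ).updateRow r (Pi.single r 1)).det := by
  classical
  rw [det_updateRow_lapMatrix]
  norm_cast
  rw [← Fintype.card_coe, ← Nat.card_eq_fintype_card]
  symm
  have hmem : ∀ f : {f ∈ parentMaps G r | Reaches f r}, (f.1 r = r ∧ ∀ v, v ≠ r → G.Adj v (f.1 v)) ∧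
      Reaches f.1 r := fun f => by
    have := f.2
    rwa [mem_filter, mem_parentMaps] at this
  have hne : ∀ f : {f ∈ parentMaps G r | Reaches f r}, ∀ v, v ≠ r → f.1 v ≠ v := fun f v hv =>
    ((hmem f).1.2 v hv).ne'
  -- A parent map goes to its underlying tree. Injectivity is the uniqueness of the orientation
  -- towards `r`. For surjectivity, the tree of a parent map chosen inside `T` is contained in `T`,
  -- hence equal to it.
  refine Nat.card_congr (Equiv.ofBijective (fun f =>
    ⟨SimpleGraph.fromRel fun v w => f.1 v = w, ?_, fromRel_isTree (hmem f).1.1 (hne f) (hmem f).2⟩)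
    ⟨fun f g hfg => ?_, fun T => ?_⟩)
  · intro a b hab
    rw [SimpleGraph.fromRel_adj] at hab
    obtain ⟨hab, rfl | rfl⟩ := hab
    · exact (hmem f).1.2 a fun h => hab (by rw [h, (hmem f).1.1])
    · exact ((hmem f).1.2 b fun h => hab (by rw [h, (hmem f).1.1])).symm
  · refine Subtype.ext (parentMap_unique (hmem g).1.1 (hmem f).1.1 (hmem g).2 fun v hv => ?_)
    have h1 : (SimpleGraph.fromRel fun v w => g.1 v = w).Adj v (g.1 v) := by
      rw [SimpleGraph.fromRel_adj]
      exact ⟨(hne g v hv).symm, Or.inl rfl⟩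
    have h2 := congrArg Subtype.val hfg
    dsimp only at h2
    rw [← h2] at h1
    exact ((SimpleGraph.fromRel_adj _ _ _).1 h1).2
  · obtain ⟨T, hTG, hT⟩ := T
    obtain ⟨f, hfr, hadj, hf⟩ := exists_parentMap hT.connected r
    refine ⟨⟨f, mem_filter.2 ⟨mem_parentMaps.2 ⟨hfr, fun v hv => hTG (hadj v hv)⟩, hf⟩⟩, ?_⟩
    refine Subtype.ext (eq_of_le_of_isTree ?_
      (fromRel_isTree hfr (fun v hv => (hadj v hv).ne') hf) hT)
    intro a b hab
    rw [SimpleGraph.fromRel_adj] at hab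
    obtain ⟨hab, rfl | rfl⟩ := hab
    · exact hadj a fun h => hab (by rw [h]; exact hfr.symm)
    · exact (hadj b fun h => hab (by rw [h]; exact hfr)).symm

end MatrixTree

/-! ### Determinants -/

open Finset Matrix

/-! ### Rank one perturbations of a Laplacian -/

section RankOne

variable {V : Type*} [Fintype V] [DecidableEq V]

/-- If the rows of `L` sum to zero, then replacing the row `r` by `v` gives a determinant which
depends only on the sum of `v`. -/
lemma det_updateRow_of_row_sum_zero {L : Matrix V V ℤ} (h : ∀ v, ∑ w, L v w = 0) (r : V)
    (v : V → ℤ) :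
    (L.updateRow r v).det = (∑ w, v w) * (L.updateRow r (Pi.single r 1)).det := by
  -- The replaced row now also sums to zero, so the all-ones vector lies in the kernel.
  have h0 : (L.updateRow r (v - (∑ w, v w) • Pi.single r 1)).det = 0 := by
    rw [← exists_mulVec_eq_zero_iff]
    refine ⟨fun _ => 1, fun h1 => one_ne_zero (congrFun h1 r), ?_⟩
    ext i
    by_cases hi : i = r
    · subst hi
      simp [mulVec, dotProduct, Finset.sum_sub_distrib, ← Finset.mul_sum]
    · simp [mulVec, dotProduct, hi, h i]
  have h1 := det_updateRow_add L r (v - (∑ w, v w) • Pi.single r 1) ((∑ w, v w) • Pi.single r 1)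
  rw [sub_add_cancel, h0, zero_add, det_updateRow_smul] at h1
  simpa using h1

/-- A rank one perturbation of a matrix whose rows and columns sum to zero. -/
lemma det_add_vecMulVec_of_sum_zero {L : Matrix V V ℤ} (h : ∀ v, ∑ w, L v w = 0)
    (h' : ∀ w, ∑ v, L v w = 0) (u v : V → ℤ) (r : V) :
    (L + vecMulVec u v).det =
      (∑ w, u w) * (∑ w, v w) * (L.updateRow r (Pi.single r 1)).det := by
  -- Adding all other rows to row `r` turns it into `(∑ u) • v`, since the columns of `L` sum to
  -- zero. With the scalar taken out, multiples of the row `v` then clear the perturbation from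
  -- every other row.
  have h1 := det_updateRow_sum (L + vecMulVec u v) r (fun _ => 1)
  have h2 : ∑ k, (1 : ℤ) • (L + vecMulVec u v) k = (∑ w, u w) • v := by
    ext j
    rw [Finset.sum_apply]
    simp [Finset.sum_add_distrib, h', vecMulVec_apply, Finset.sum_mul]
  rw [h2, one_smul, det_updateRow_smul] at h1
  rw [← h1, mul_assoc, ← det_updateRow_of_row_sum_zero h r v]
  congr 1
  refine det_eq_of_forall_row_eq_smul_add_const (fun i => if i = r then 0 else u i) r (by simp) ?_
  intro i j
  by_cases hi : i = r
  · subst hi; simp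
  · simp [hi, vecMulVec_apply]

end RankOne

/-! ### Tridiagonal determinants and Chebyshev values -/

section Tridiagonal

variable {S : Type*} [CommRing S]

/-- The tridiagonal matrix with diagonal `d` and entries `-1` next to the diagonal. -/
def tridiag (d : ℕ → S) (n : ℕ) : Matrix (Fin n) (Fin n) S :=
  of fun i j => if i = j then d i else if (i : ℕ) + 1 = j ∨ (j : ℕ) + 1 = i then -1 else 0

/-- The continuant recurrence: expand along the first row, then expand the second minor along its
first column. -/
lemma det_tridiag_succ_succ (d : ℕ → S) (n : ℕ) :
    (tridiag d (n + 2)).det = d 0 * (tridiag (fun i => d (i + 1)) (n + 1)).det -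
      (tridiag (fun i => d (i + 2)) n).det := by
  rw [det_succ_row_zero, Fin.sum_univ_succ, Fin.sum_univ_succ, Finset.sum_eq_zero]
  · have h1 : (tridiag d (n + 2)).submatrix Fin.succ (Fin.succAbove 0) =
        tridiag (fun i => d (i + 1)) (n + 1) := by
      ext i j
      simp [tridiag, Fin.ext_iff]
    have h2 : ((tridiag d (n + 2)).submatrix Fin.succ (Fin.succAbove (Fin.succ 0))).det =
        - (tridiag (fun i => d (i + 2)) n).det := by
      rw [det_succ_column_zero, Fin.sum_univ_succ, Finset.sum_eq_zero]
      · have h3 : ((tridiag d (n + 2)).submatrix Fin.succ (Fin.succAbove (Fin.succ 0))).submatrix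
            (Fin.succAbove 0) Fin.succ = tridiag (fun i => d (i + 2)) n := by
          ext i j
          simp [tridiag, Fin.ext_iff, Fin.succAbove, Fin.lt_def]
        rw [h3]
        simp [tridiag, Fin.succAbove]
      · intro i _
        have : (tridiag d (n + 2)).submatrix Fin.succ (Fin.succAbove (Fin.succ 0)) i.succ 0 = 0 := by
          simp [tridiag, Fin.ext_iff, Fin.succAbove]
        rw [this]; ring
    rw [h1, h2]
    simp [tridiag]
    ring
  · intro i _
    have : tridiag d (n + 2) 0 i.succ.succ = 0 := by
      simp [tridiag, Fin.ext_iff]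
    rw [this]; ring

end Tridiagonal

/-- The sequence `0, 1, 2 + x, …` of values of Chebyshev polynomials of the second kind. -/
def chebU {R : Type*} [Ring R] (x : R) : ℕ → R
  | 0 => 0
  | 1 => 1
  | n + 2 => (2 + x) * chebU x (n + 1) - chebU x n

lemma map_chebU {R R' : Type*} [Ring R] [Ring R'] (f : R →+* R') (x : R) (n : ℕ) :
    f (chebU x n) = chebU (f x) n := by
  induction n using Nat.twoStepInduction with
  | zero => simp [chebU]
  | one => simp [chebU]
  | more n h1 h2 => rw [chebU, chebU, map_sub, map_mul, map_add, h1, h2, map_ofNat]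

section PathDet

variable {S : Type*} [CommRing S]

/-- The determinant of `x` plus the Laplacian of a path of `m` vertices grounded at its start. -/
def pathDet (x : S) (m : ℕ) : S := (tridiag (fun i => x + 1 + if i + 1 < m then 1 else 0) m).det

lemma pathDet_zero (x : S) : pathDet x 0 = 1 := det_isEmpty

lemma pathDet_one (x : S) : pathDet x 1 = x + 1 := by
  simp [pathDet, tridiag]

lemma pathDet_succ_succ (x : S) (m : ℕ) :
    pathDet x (m + 2) = (2 + x) * pathDet x (m + 1) - pathDet x m := by
  unfold pathDet
  rw [det_tridiag_succ_succ]
  simp only [add_lt_add_iff_right, zero_add, show 1 < m + 2 by omega, if_true,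
    show ∀ i, (i + 1 + 1 < m + 2 ↔ i + 1 < m + 1) from fun i => by omega]
  ring

lemma pathDet_succ_sub (x : S) (m : ℕ) :
    pathDet x (m + 1) - pathDet x m = x * chebU x (m + 1) := by
  induction m using Nat.twoStepInduction with
  | zero => simp [pathDet_one, pathDet_zero, chebU]
  | one => rw [pathDet_succ_succ]; simp [pathDet_one, pathDet_zero, chebU]; ring
  | more m h1 h2 =>
    rw [pathDet_succ_succ x (m + 1), chebU]
    have := pathDet_succ_succ x m
    linear_combination (2 + x) * h2 - h1 - this

/-- Multiplication by `j` amounts to setting `x = 0`, where every `pathDet` is `1`. -/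
lemma pathDet_mul_of_mul_eq_zero {x j : S} (h : x * j = 0) (m : ℕ) : pathDet x m * j = j := by
  induction m using Nat.twoStepInduction with
  | zero => simp [pathDet_zero]
  | one => rw [pathDet_one]; linear_combination h
  | more m h1 h2 =>
    rw [pathDet_succ_succ]
    linear_combination (2 + x) * h2 - h1 + h

/-- Only the first diagonal entry contains `j`. Write `P m` for `pathDet x m`; for at least two
vertices, expansion at that entry gives `(x + 1) * P (n + 1) - P n + j * P (n + 1)`. The first two
terms equal `P (n + 2) - P (n + 1)`, a Chebyshev value times `x`, and the last is `j`. -/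
lemma det_tridiag_path {x j : S} (h : x * j = 0) (n : ℕ) :
    (tridiag (fun i => x + ((if 0 < i then 1 else 0) + if i + 1 < n + 1 then 1 else 0) +
      if i = 0 then j else 0) (n + 1)).det = x * chebU x (n + 1) + j := by
  cases n with
  | zero => simp [tridiag, chebU]
  | succ n =>
    set d : ℕ → S := fun i => x + ((if 0 < i then 1 else 0) + if i + 1 < n + 1 + 1 then 1 else 0) +
      if i = 0 then j else 0 with hd
    have h0 : d 0 = x + 1 + j := by simp [hd]
    have h1 : (fun i => d (i + 1)) = fun i => x + 1 + if i + 1 < n + 1 then 1 else 0 := by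
      funext i
      simp [hd, add_assoc]
    have h2 : (fun i => d (i + 2)) = fun i => x + 1 + if i + 1 < n then 1 else 0 := by
      funext i
      simp [hd, add_assoc, Nat.lt_iff_add_one_le]
    rw [det_tridiag_succ_succ, h0, h1, h2]
    change _ * pathDet x (n + 1) - pathDet x n = _
    rw [← pathDet_succ_sub x (n + 1), pathDet_succ_succ]
    linear_combination pathDet_mul_of_mul_eq_zero h (n + 1)

end PathDet

/-! ### The Laplacian of the grid -/

/-- The Laplacian matrix of the path with `n` vertices. -/
def pathLap (n : ℕ) : Matrix (Fin n) (Fin n) ℤ :=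
  of fun i j => if i = j then (if 0 < (i : ℕ) then 1 else 0) + (if (i : ℕ) + 1 < n then 1 else 0)
    else if (i : ℕ) + 1 = j ∨ (j : ℕ) + 1 = i then -1 else 0

lemma sum_pathLap (n : ℕ) (i : Fin n) : ∑ j, pathLap n i j = 0 := by
  have h : ∀ j, pathLap n i j =
      (if i = j then (if 0 < (i : ℕ) then 1 else 0) + (if (i : ℕ) + 1 < n then 1 else 0) else 0) -
        (if (i : ℕ) + 1 = j then 1 else 0) - (if (j : ℕ) + 1 = i then 1 else 0) := by
    intro j
    simp only [pathLap, of_apply, Fin.ext_iff]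
    split_ifs <;> omega
  have h1 : ∑ j : Fin n, (if (i : ℕ) + 1 = j then (1 : ℤ) else 0) =
      if (i : ℕ) + 1 < n then 1 else 0 := by
    split_ifs with hi
    · rw [Finset.sum_eq_single ⟨i + 1, hi⟩]
      · simp
      · intro b _ hb
        rw [if_neg fun h => hb (Fin.ext h.symm)]
      · simp
    · exact Finset.sum_eq_zero fun j _ => if_neg (by omega)
  have h2 : ∑ j : Fin n, (if (j : ℕ) + 1 = i then (1 : ℤ) else 0) =
      if 0 < (i : ℕ) then 1 else 0 := by
    split_ifs with hi
    · rw [Finset.sum_eq_single ⟨i - 1, by omega⟩]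
      · rw [if_pos]; simp only; omega
      · intro b _ hb
        rw [if_neg fun h => hb (Fin.ext (by simp only; omega))]
      · simp
    · exact Finset.sum_eq_zero fun j _ => if_neg (by omega)
  simp only [h, Finset.sum_sub_distrib, h1, h2, Finset.sum_ite_eq, mem_univ, if_true]
  ring

lemma pathLap_comm (n : ℕ) (i j : Fin n) : pathLap n i j = pathLap n j i := by
  by_cases h : i = j
  · rw [h]
  · simp only [pathLap, of_apply, h, Ne.symm h, if_false, or_comm]

/-- The Laplacian of the grid as a Kronecker sum. -/
def gridLap (k n : ℕ) : Matrix (Fin k × Fin n) (Fin k × Fin n) ℤ :=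
  of fun p q => (if p.2 = q.2 then pathLap k p.1 q.1 else 0) +
    if p.1 = q.1 then pathLap n p.2 q.2 else 0

lemma sum_gridLap (k n : ℕ) (p : Fin k × Fin n) : ∑ q, gridLap k n p q = 0 := by
  simp only [gridLap, of_apply, Finset.sum_add_distrib, Fintype.sum_prod_type]
  simp [sum_pathLap]

lemma gridLap_comm (k n : ℕ) (p q : Fin k × Fin n) : gridLap k n p q = gridLap k n q p := by
  simp only [gridLap, of_apply, pathLap_comm k p.1, pathLap_comm n p.2, eq_comm]

/-- Off the diagonal the entries are compared case by case. The diagonal then needs no degree count,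
since all rows of both matrices sum to zero. -/
lemma lapMatrix_gridGraph (k n : ℕ) [DecidableRel (gridGraph k n).Adj] :
    (gridGraph k n).lapMatrix ℤ = gridLap k n := by
  have hoff : ∀ p q, p ≠ q → (gridGraph k n).lapMatrix ℤ p q = gridLap k n p q := by
    rintro ⟨i, j⟩ ⟨i', j'⟩ h
    have hadj : (gridGraph k n).Adj (i, j) (i', j') ↔
      |(i : ℤ) - (i' : ℤ)| + |(j : ℤ) - (j' : ℤ)| = 1 := Iff.rfl
    have hne : ¬ ((i : ℕ) = i' ∧ (j : ℕ) = j') := fun h' =>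
      h (Prod.ext (Fin.ext h'.1) (Fin.ext h'.2))
    simp only [SimpleGraph.lapMatrix, SimpleGraph.degMatrix, Matrix.sub_apply, diagonal_apply_ne _ h,
      SimpleGraph.adjMatrix_apply, hadj, gridLap, pathLap, of_apply, Fin.ext_iff, abs]
    split_ifs <;> omega
  ext p q
  by_cases h : p = q
  · subst h
    have h1 : ∑ q, (gridGraph k n).lapMatrix ℤ p q = 0 := by
      have := congrFun ((gridGraph k n).lapMatrix_mulVec_const_eq_zero (R := ℤ)) p
      simpa [mulVec, dotProduct] using this
    have h2 := sum_gridLap k n p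
    rw [← Finset.add_sum_erase _ _ (mem_univ p)] at h1 h2
    rw [Finset.sum_congr rfl fun q hq => hoff p q (Finset.ne_of_mem_erase hq).symm] at h1
    linarith
  · exact hoff p q h

/-- The all-ones matrix. -/
def onesMatrix (k : ℕ) : Matrix (Fin k) (Fin k) ℤ := of fun _ _ => 1

lemma pathLap_mul_onesMatrix (k : ℕ) : pathLap k * onesMatrix k = 0 := by
  ext i j
  simp [mul_apply, onesMatrix, sum_pathLap]

lemma onesMatrix_mul_pathLap (k : ℕ) : onesMatrix k * pathLap k = 0 := by
  ext i j
  simp [mul_apply, onesMatrix, pathLap_comm k _ j, sum_pathLap]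

/-- Ordered column by column, the grid Laplacian is block tridiagonal with off-diagonal blocks `-1`,
and grounding adds the all-ones block in the first diagonal position. -/
lemma map_tridiag_apply {S : Type*} [CommRing S] {k : ℕ} (f : S →+* Matrix (Fin k) (Fin k) ℤ)
    {x j : S} (hx : f x = pathLap k) (hj : f j = onesMatrix k) (n : ℕ) (b b' : Fin (n + 1))
    (a a' : Fin k) :
    f (tridiag (fun i => x + ((if 0 < i then 1 else 0) + if i + 1 < n + 1 then 1 else 0) +
      if i = 0 then j else 0) (n + 1) b b') a a' =
    gridLap k (n + 1) (a, b) (a', b') +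
      (if b = 0 then 1 else 0) * (if b' = 0 then 1 else 0) := by
  simp only [gridLap, of_apply, tridiag]
  by_cases hb : b = b'
  · subst hb
    have hif : ∀ (c : Prop) [Decidable c], f (if c then 1 else 0) a a' =
        if a = a' then (if c then 1 else 0) else 0 := by
      intro c _
      by_cases hc : c <;> simp [hc, one_apply]
    have hjf : f (if (b : ℕ) = 0 then j else 0) a a' = if (b : ℕ) = 0 then 1 else 0 := by
      by_cases hc : (b : ℕ) = 0 <;> simp [hc, hj, onesMatrix]
    have h0 : b = 0 ↔ (b : ℕ) = 0 := Fin.ext_iff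
    simp only [if_true, map_add, Matrix.add_apply, hif, hjf, hx, h0]
    simp only [pathLap, of_apply, if_true]
    by_cases ha : a = a'
    · by_cases hb0 : (b : ℕ) = 0 <;> simp [ha, hb0]
    · by_cases hb0 : (b : ℕ) = 0 <;> simp [ha, hb0]
  · have h0 : ¬ (b = 0 ∧ b' = 0) := fun h => hb (h.1.trans h.2.symm)
    have h1 : ((if b = 0 then 1 else 0) * (if b' = 0 then 1 else 0) : ℤ) = 0 := by
      by_cases h : b = 0
      · rw [if_neg fun h' => h0 ⟨h, h'⟩, mul_zero]
      · rw [if_neg h, zero_mul]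
    rw [h1]
    simp only [hb, if_false, pathLap, of_apply, zero_add, add_zero]
    by_cases hc : (b : ℕ) + 1 = b' ∨ (b' : ℕ) + 1 = b
    · simp [hc, one_apply]
      split_ifs <;> rfl
    · simp [hc]

open scoped IsMulCommutative in
/-- The Laplacian of the grid, grounded along its first column. -/
lemma det_gridLap_add (k n : ℕ) :
    (gridLap k (n + 1) + vecMulVec (fun p : Fin k × Fin (n + 1) => if p.2 = 0 then 1 else 0)
      (fun p : Fin k × Fin (n + 1) => if p.2 = 0 then 1 else 0)).det =
    (pathLap k * chebU (pathLap k) (n + 1) + onesMatrix k).det := by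
  -- The two generators annihilate each other on both sides, so the subalgebra they generate is
  -- commutative and the tridiagonal formula applies in it.
  let s : Set (Matrix (Fin k) (Fin k) ℤ) := {pathLap k, onesMatrix k}
  have hs : ∀ a ∈ s, ∀ b ∈ s, a * b = b * a := by
    rintro a (rfl | rfl) b (rfl | rfl) <;>
      simp [pathLap_mul_onesMatrix, onesMatrix_mul_pathLap]
  have := Algebra.isMulCommutative_adjoin ℤ hs
  let f : Algebra.adjoin ℤ s →+* Matrix (Fin k) (Fin k) ℤ := (Algebra.adjoin ℤ s).val.toRingHom
  let x : Algebra.adjoin ℤ s := ⟨pathLap k, Algebra.subset_adjoin (Or.inl rfl)⟩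
  let j : Algebra.adjoin ℤ s := ⟨onesMatrix k, Algebra.subset_adjoin (Or.inr rfl)⟩
  have hxj : x * j = 0 := Subtype.ext (pathLap_mul_onesMatrix k)
  have hdet := congrArg f (det_tridiag_path hxj n)
  rw [map_add, map_mul, map_chebU] at hdet
  change _ = pathLap k * chebU (pathLap k) (n + 1) + onesMatrix k at hdet
  -- For commuting blocks, the determinant of the large matrix is the determinant of the block
  -- determinant.
  rw [← hdet, Matrix.det_det, ← det_submatrix_equiv_self (Equiv.prodComm (Fin (n + 1)) (Fin k))]
  congr 1
  ext ⟨b, a⟩ ⟨b', a'⟩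
  exact (map_tridiag_apply f (x := x) (j := j) rfl rfl n b b' a a').symm

/-- The number of spanning trees of the grid as a determinant of the size of a column. -/
lemma sq_mul_numSpanningTrees (k n : ℕ) (hk : 0 < k) :
    (k : ℤ) ^ 2 * numSpanningTrees k (n + 1) =
      (pathLap k * chebU (pathLap k) (n + 1) + onesMatrix k).det := by
  classical
  rw [← det_gridLap_add, det_add_vecMulVec_of_sum_zero (sum_gridLap k (n + 1))
    (fun w => by simp only [gridLap_comm _ _ _ w, sum_gridLap]) _ _ (⟨0, hk⟩, 0),
    ← lapMatrix_gridGraph, ← MatrixTree.card_spanningTrees]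
  have : ∑ p : Fin k × Fin (n + 1), (if p.2 = 0 then (1 : ℤ) else 0) = k := by
    rw [Fintype.sum_prod_type]
    simp
  rw [this, numSpanningTrees]
  ring

/-! ### Block diagonalisation of the path Laplacian -/

lemma chebU_mul_eq_mul_chebU {R : Type*} [Ring R] {a b p : R} (h : a * p = p * b) (m : ℕ) :
    chebU a m * p = p * chebU b m := by
  induction m using Nat.twoStepInduction with
  | zero => simp [chebU]
  | one => simp [chebU]
  | more m h1 h2 =>
    rw [chebU, chebU, sub_mul, mul_assoc, h2, h1, ← mul_assoc, add_mul, h, mul_sub, ← mul_assoc p,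
      mul_add, two_mul, mul_two]

lemma chebU_fromBlocks {m n : Type*} [Fintype m] [DecidableEq m] [Fintype n] [DecidableEq n]
    (A : Matrix m m ℤ) (B : Matrix n n ℤ) (i : ℕ) :
    chebU (fromBlocks A 0 0 B) i = fromBlocks (chebU A i) 0 0 (chebU B i) := by
  induction i using Nat.twoStepInduction with
  | zero => simp [chebU]
  | one => simp [chebU]
  | more i h1 h2 =>
    have h : (2 : Matrix (m ⊕ n) (m ⊕ n) ℤ) = fromBlocks 2 0 0 2 := by
      rw [← one_add_one_eq_two, ← fromBlocks_one, fromBlocks_add, one_add_one_eq_two,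
        one_add_one_eq_two, add_zero, add_zero]
    rw [chebU, h1, h2, chebU, chebU, h, fromBlocks_add, fromBlocks_multiply, sub_eq_add_neg,
      fromBlocks_neg, fromBlocks_add]
    simp [sub_eq_add_neg]

/-- The number of spanning trees of the grid, from a decomposition of the path Laplacian. -/
lemma numSpanningTrees_eq_det {ι : Type*} [Fintype ι] [DecidableEq ι] {k : ℕ} (hk : 0 < k)
    (e : Fin 1 ⊕ ι ≃ Fin k) (P : Matrix (Fin 1 ⊕ ι) (Fin 1 ⊕ ι) ℤ) (hP : P.det ≠ 0)
    (B : Matrix ι ι ℤ) (hB : B.det = k)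
    (hL : (pathLap k).submatrix e e * P = P * fromBlocks 0 0 0 B)
    (hJ : (onesMatrix k).submatrix e e * P = P * fromBlocks (k : Matrix (Fin 1) (Fin 1) ℤ) 0 0 0)
    (n : ℕ) : (numSpanningTrees k (n + 1) : ℤ) = (chebU B (n + 1)).det := by
  have hU : (chebU (pathLap k) (n + 1)).submatrix e e * P =
      P * fromBlocks (chebU 0 (n + 1)) 0 0 (chebU B (n + 1)) := by
    rw [← chebU_fromBlocks, ← chebU_mul_eq_mul_chebU hL]
    congr 1
    exact map_chebU (reindexRingEquiv ℤ e.symm).toRingHom (pathLap k) (n + 1)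
  -- In the basis `P` the constants contribute `k` and the complement contributes `det B = k` times
  -- the wanted determinant, which cancels the factor `k ^ 2`.
  have h1 : (pathLap k * chebU (pathLap k) (n + 1) + onesMatrix k).submatrix e e * P =
      P * fromBlocks (k : Matrix (Fin 1) (Fin 1) ℤ) 0 0 (B * chebU B (n + 1)) := by
    rw [submatrix_add, Pi.add_apply, Pi.add_apply, Matrix.add_mul, ← submatrix_mul_equiv _ _ e e e,
      Matrix.mul_assoc, hU, ← Matrix.mul_assoc, hL, hJ, Matrix.mul_assoc, ← Matrix.mul_add,
      fromBlocks_multiply, fromBlocks_add]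
    simp
  have h2 := congrArg det h1
  rw [det_mul, det_mul, det_submatrix_equiv_self, ← sq_mul_numSpanningTrees k n hk,
    det_fromBlocks_zero₂₁, det_mul, hB, mul_comm] at h2
  have h3 := mul_left_cancel₀ hP h2
  have hk' : (k : ℤ) ≠ 0 := by exact_mod_cast hk.ne'
  have h4 : ((k : Matrix (Fin 1) (Fin 1) ℤ)).det = k := by
    rw [det_unique, ← diagonal_natCast, diagonal_apply_eq]
  rw [h4] at h3
  exact mul_left_cancel₀ (pow_ne_zero 2 hk') (by rw [h3]; ring)

/-! ### Linear recurrences -/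

/-- The linear combination `c₀ sₙ + c₁ sₙ₊₁ + ⋯`. -/
def lincomb : List ℤ → (ℕ → ℤ) → ℕ → ℤ
  | [], _, _ => 0
  | c :: l, s, n => c * s n + lincomb l s (n + 1)

lemma lincomb_append_singleton (l : List ℤ) (x : ℤ) (s : ℕ → ℤ) (n : ℕ) :
    lincomb (l ++ [x]) s n = lincomb l s n + x * s (n + l.length) := by
  induction l generalizing n with
  | nil => simp [lincomb]
  | cons c l ih =>
    rw [List.cons_append, lincomb, ih, lincomb, List.length_cons,
      show n + 1 + l.length = n + (l.length + 1) by omega]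
    ring

lemma lincomb_congr (l : List ℤ) {s t : ℕ → ℤ} (n : ℕ)
    (h : ∀ i, n ≤ i → i < n + l.length → s i = t i) : lincomb l s n = lincomb l t n := by
  induction l generalizing n with
  | nil => rfl
  | cons c l ih =>
    rw [List.length_cons] at h
    rw [lincomb, lincomb, h n le_rfl (by omega), ih (n + 1) fun i h1 h2 => h i (by omega) (by omega)]

lemma lincomb_zero (l : List ℤ) (n : ℕ) : lincomb l (fun _ => 0) n = 0 := by
  induction l generalizing n with
  | nil => rfl
  | cons c l ih => rw [lincomb, ih, mul_zero, add_zero]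

lemma lincomb_mul_add (l : List ℤ) (x : ℤ) (s t : ℕ → ℤ) (n : ℕ) :
    lincomb l (fun i => x * s i + t i) n = x * lincomb l s n + lincomb l t n := by
  induction l generalizing n with
  | nil => simp [lincomb]
  | cons c l ih => rw [lincomb, lincomb, lincomb, ih]; ring

lemma lincomb_shift (l : List ℤ) (s : ℕ → ℤ) (n : ℕ) :
    lincomb l (fun i => s (i + 1)) n = lincomb l s (n + 1) := by
  induction l generalizing n with
  | nil => rfl
  | cons c l ih => rw [lincomb, lincomb, ih]

/-- The sequence `s` satisfies the monic linear recurrence with coefficients `c`. -/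
def IsRec (c : List ℤ) (s : ℕ → ℤ) : Prop := ∀ n, lincomb (c ++ [1]) s n = 0

/-- Only the range below `N` is required of `t`, so that `t` may be a finite table continued by
zeros. -/
lemma IsRec.eq_of_initial {c : List ℤ} {s t : ℕ → ℤ} {N : ℕ} (hs : IsRec c s)
    (ht : ∀ n, n + c.length < N → lincomb (c ++ [1]) t n = 0)
    (h : ∀ n, n < c.length → s n = t n) : ∀ n, n < N → s n = t n := by
  intro n
  induction n using Nat.strong_induction_on with
  | _ n ih =>
    intro hn
    by_cases hc : n < c.length
    · exact h n hc
    · obtain ⟨m, rfl⟩ := Nat.exists_eq_add_of_le (not_lt.1 hc)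
      have h1 := hs m
      have h2 := ht m (by omega)
      rw [lincomb_append_singleton] at h1 h2
      rw [lincomb_congr c m fun i _ h2 => ih i (by omega) (by omega)] at h1
      rw [add_comm c.length m]
      linarith

lemma IsRec.eq_zero {c : List ℤ} {s : ℕ → ℤ} (hs : IsRec c s)
    (h : ∀ n, n < c.length → s n = 0) (n : ℕ) : s n = 0 :=
  hs.eq_of_initial (t := fun _ => 0) (N := n + 1) (fun _ _ => lincomb_zero _ _) h n (by omega)

/-- The combination `d₀ aₙ bₘ + d₁ aₙ₊₁ bₘ₊₁ + ⋯`. -/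
def lincomb₂ : List ℤ → (ℕ → ℤ) → (ℕ → ℤ) → ℕ → ℕ → ℤ
  | [], _, _, _, _ => 0
  | d :: l, a, b, n, m => d * (a n * b m) + lincomb₂ l a b (n + 1) (m + 1)

lemma lincomb₂_self (d : List ℤ) (a b : ℕ → ℤ) (n : ℕ) :
    lincomb₂ d a b n n = lincomb d (fun i => a i * b i) n := by
  induction d generalizing n with
  | nil => rfl
  | cons x l ih => rw [lincomb₂, lincomb, ih]

lemma lincomb₂_comm (d : List ℤ) (a b : ℕ → ℤ) (n m : ℕ) :
    lincomb₂ d a b n m = lincomb₂ d b a m n := by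
  induction d generalizing n m with
  | nil => rfl
  | cons x l ih => rw [lincomb₂, lincomb₂, ih, mul_comm (a n)]

/-- For fixed `m` this is a combination of shifts of `a` with constant coefficients. -/
lemma IsRec.lincomb₂_left {c : List ℤ} {a : ℕ → ℤ} (ha : IsRec c a) (b : ℕ → ℤ) (d : List ℤ)
    (m : ℕ) : IsRec c fun n => lincomb₂ d a b n m := by
  induction d generalizing m with
  | nil => exact fun n => lincomb_zero _ n
  | cons x l ih =>
    intro n
    have h : (fun n => lincomb₂ (x :: l) a b n m) =
        fun n => (x * b m) * a n + (fun i => lincomb₂ l a b i (m + 1)) (n + 1) := by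
      funext n
      simp only [lincomb₂]
      ring
    rw [h, lincomb_mul_add, ha n, lincomb_shift _ (fun i => lincomb₂ l a b i (m + 1)), ih]
    ring

/-- A recurrence for a product of two recurrent sequences may be checked on finitely many values. -/
lemma IsRec.mul {c c' d : List ℤ} {a b : ℕ → ℤ} (ha : IsRec c a) (hb : IsRec c' b)
    (h : ∀ n, n < c.length → ∀ m, m < c'.length → lincomb₂ (d ++ [1]) a b n m = 0) :
    IsRec d fun n => a n * b n := by
  intro n
  rw [← lincomb₂_self]
  -- The wanted expression is the diagonal of a double sequence that is recurrent in each index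
  -- separately. Vanishing on the initial rectangle propagates in one index and then in the other.
  refine (ha.lincomb₂_left b (d ++ [1]) n).eq_zero (fun i hi => ?_) n
  have h1 : IsRec c' fun m => lincomb₂ (d ++ [1]) a b i m := by
    simp only [lincomb₂_comm _ a b]
    exact hb.lincomb₂_left a (d ++ [1]) i
  exact h1.eq_zero (h i hi) n

lemma lincomb₂_congr (l : List ℤ) {a a' b b' : ℕ → ℤ} {N : ℕ} (n m : ℕ)
    (ha : ∀ i, i < N → a i = a' i) (hb : ∀ i, i < N → b i = b' i)
    (hn : n + l.length ≤ N) (hm : m + l.length ≤ N) :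
    lincomb₂ l a b n m = lincomb₂ l a' b' n m := by
  induction l generalizing n m with
  | nil => rfl
  | cons c l ih =>
    rw [List.length_cons] at hn hm
    rw [lincomb₂, lincomb₂, ha n (by omega), hb m (by omega),
      ih (n + 1) (m + 1) (by omega) (by omega)]

/-! ### Chebyshev values of small matrices -/

/-- The sequence `0, 1, …` with `uₙ₊₂ = M uₙ₊₁ - uₙ`, where `M ^ 2 = t M - d`, in the basis `1, M`. -/
def quadSeq (t d : ℤ) : ℕ → ℤ × ℤ
  | 0 => (0, 0)
  | 1 => (1, 0)
  | n + 2 => (-d * (quadSeq t d (n + 1)).2 - (quadSeq t d n).1,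
      (quadSeq t d (n + 1)).1 + t * (quadSeq t d (n + 1)).2 - (quadSeq t d n).2)

/-- The norm of `p + q M`, where `M ^ 2 = t M - d`. -/
def quadForm (t d : ℤ) (v : ℤ × ℤ) : ℤ := v.1 ^ 2 + t * v.1 * v.2 + d * v.2 ^ 2

/-- The sequence `0, 1, …` with `uₙ₊₂ = M uₙ₊₁ - uₙ`, where `M ^ 3 = x M ^ 2 - y M + z`, in the basis
`1, M, M ^ 2`. -/
def cubicSeq (x y z : ℤ) : ℕ → ℤ × ℤ × ℤ
  | 0 => (0, 0, 0)
  | 1 => (1, 0, 0)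
  | n + 2 => (z * (cubicSeq x y z (n + 1)).2.2 - (cubicSeq x y z n).1,
      (cubicSeq x y z (n + 1)).1 - y * (cubicSeq x y z (n + 1)).2.2 - (cubicSeq x y z n).2.1,
      (cubicSeq x y z (n + 1)).2.1 + x * (cubicSeq x y z (n + 1)).2.2 - (cubicSeq x y z n).2.2)

/-- The norm of `p + q M + r M ^ 2`, where `M ^ 3 = x M ^ 2 - y M + z`. -/
def cubicForm (x y z : ℤ) (v : ℤ × ℤ × ℤ) : ℤ :=
  v.1 ^ 3 + z * v.2.1 ^ 3 + z ^ 2 * v.2.2 ^ 3 + x * v.1 ^ 2 * v.2.1 +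
    (x ^ 2 - 2 * y) * v.1 ^ 2 * v.2.2 + y * v.1 * v.2.1 ^ 2 +
    (y ^ 2 - 2 * x * z) * v.1 * v.2.2 ^ 2 + x * z * v.2.1 ^ 2 * v.2.2 +
    y * z * v.2.1 * v.2.2 ^ 2 + (x * y - 3 * z) * v.1 * v.2.1 * v.2.2

lemma chebU_eq_quadSeq {R : Type*} [Ring R] {B M : R} (hM : 2 + B = M) {t d : ℤ}
    (h : M ^ 2 = t • M - d • 1) (n : ℕ) :
    chebU B n = (quadSeq t d n).1 • (1 : R) + (quadSeq t d n).2 • M := by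
  induction n using Nat.twoStepInduction with
  | zero => simp [chebU, quadSeq]
  | one => simp [chebU, quadSeq]
  | more n h1 h2 =>
    rw [chebU, h1, h2, quadSeq, hM, mul_add, mul_smul_comm, mul_smul_comm, mul_one, ← sq, h]
    module

lemma chebU_eq_cubicSeq {R : Type*} [Ring R] {B M : R} (hM : 2 + B = M) {x y z : ℤ}
    (h : M ^ 3 = x • M ^ 2 - y • M + z • 1) (n : ℕ) :
    chebU B n = (cubicSeq x y z n).1 • (1 : R) + (cubicSeq x y z n).2.1 • M +
      (cubicSeq x y z n).2.2 • M ^ 2 := by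
  induction n using Nat.twoStepInduction with
  | zero => simp [chebU, cubicSeq]
  | one => simp [chebU, cubicSeq]
  | more n h1 h2 =>
    rw [chebU, h1, h2, cubicSeq, hM, mul_add, mul_add, mul_smul_comm, mul_smul_comm, mul_smul_comm,
      mul_one, ← sq, ← pow_succ', h]
    module

lemma det_chebU_fin_one (b : ℤ) (n : ℕ) : (chebU !![b] n).det = chebU b n := by
  have h : ∀ n, chebU !![b] n = !![chebU b n] := by
    intro n
    induction n using Nat.twoStepInduction with
    | zero => ext i j; fin_cases i; fin_cases j; simp [chebU]
    | one => ext i j; fin_cases i; fin_cases j; simp [chebU]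
    | more n h1 h2 =>
      have h3 : (2 : Matrix (Fin 1) (Fin 1) ℤ) = !![2] := by decide
      rw [chebU, h1, h2, chebU, h3]
      ext i j
      fin_cases i
      fin_cases j
      simp
  simp [h]

lemma det_chebU_fin_two (a b c d : ℤ) (n : ℕ) :
    (chebU !![a, b; c, d] n).det = quadForm (a + d + 4) ((a + 2) * (d + 2) - b * c)
      (quadSeq (a + d + 4) ((a + 2) * (d + 2) - b * c) n) := by
  have hM : 2 + !![a, b; c, d] = !![a + 2, b; c, d + 2] := by
    rw [← one_add_one_eq_two (R := Matrix (Fin 2) (Fin 2) ℤ), one_fin_two]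
    simp [add_comm]
  rw [chebU_eq_quadSeq hM (t := a + d + 4) (d := (a + 2) * (d + 2) - b * c), det_fin_two, quadForm,
    one_fin_two]
  · simp only [Matrix.add_apply, Matrix.smul_apply, of_apply, cons_val', cons_val_zero,
      cons_val_one, cons_val_fin_one, smul_eq_mul]
    ring
  · rw [one_fin_two, sq, smul_of, smul_of, mul_fin_two]
    ext i j
    fin_cases i <;> fin_cases j <;> simp <;> ring

/-- The norm formula `hdet` is a separate hypothesis, because a cubic annihilating `M` need not be
its characteristic polynomial. -/
lemma det_chebU_fin_three {B M : Matrix (Fin 3) (Fin 3) ℤ} (hM : 2 + B = M) {x y z : ℤ}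
    (h : M ^ 3 = x • M ^ 2 - y • M + z • 1)
    (hdet : ∀ p q r : ℤ, (p • 1 + q • M + r • M ^ 2).det = cubicForm x y z (p, q, r)) (n : ℕ) :
    (chebU B n).det = cubicForm x y z (cubicSeq x y z n) := by
  rw [chebU_eq_cubicSeq hM h, hdet]

/-! ### Recurrences for the determinant factors -/

lemma isRec_chebU (b : ℤ) : IsRec [1, -(2 + b)] (chebU b) := by
  intro n
  have : chebU b (n + 1 + 1) = _ := chebU.eq_3 b n
  simp only [List.cons_append, List.nil_append, lincomb, this]
  ring

/-- If the eigenvalues of `M` are `θ + θ⁻¹` and `φ + φ⁻¹`, the characteristic roots are the four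
products `θ^±1 φ^±1`. The recurrence is an identity in two arbitrary consecutive states. -/
lemma isRec_quadForm (t d : ℤ) :
    IsRec [1, -d, t ^ 2 - 2 * d - 2, -d] fun n => quadForm t d (quadSeq t d n) := by
  intro n
  simp only [List.cons_append, List.nil_append, lincomb, quadSeq, quadForm]
  generalize quadSeq t d n = u
  generalize quadSeq t d (n + 1) = v
  ring

lemma isRec_cubicForm_sym_six :
    IsRec [1, -52, 673, -2548, 3856, -2548, 673, -52] fun n =>
      cubicForm 12 45 52 (cubicSeq 12 45 52 n) := by
  intro n
  simp only [List.cons_append, List.nil_append, lincomb]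
  generalize hu : cubicSeq 12 45 52 n = u
  generalize hv : cubicSeq 12 45 52 (n + 1) = v
  -- Each later state is written as an explicit linear expression in `u` and `v`, so that the final
  -- `ring` is an identity of cubic forms in six variables.
  have h2 : cubicSeq 12 45 52 (n + 1 + 1) = (-u.1 + 52 * v.2.2,
      -u.2.1 + v.1 - 45 * v.2.2,
      -u.2.2 + v.2.1 + 12 * v.2.2) := by
    rw [cubicSeq, hv, hu]
    ext <;> ring
  have h3 : cubicSeq 12 45 52 (n + 1 + 1 + 1) = (-52 * u.2.2 - v.1 + 52 * v.2.1 + 624 * v.2.2,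
      -u.1 + 45 * u.2.2 - 46 * v.2.1 - 488 * v.2.2,
      -u.2.1 - 12 * u.2.2 + v.1 + 12 * v.2.1 + 98 * v.2.2) := by
    rw [cubicSeq, h2, hv]
    ext <;> ring
  have h4 : cubicSeq 12 45 52 (n + 1 + 1 + 1 + 1) = (u.1 - 52 * u.2.1 - 624 * u.2.2 + 52 * v.1 + 624 * v.2.1 + 5044 * v.2.2,
      46 * u.2.1 + 488 * u.2.2 - 47 * v.1 - 488 * v.2.1 - 3741 * v.2.2,
      -u.1 - 12 * u.2.1 - 98 * u.2.2 + 12 * v.1 + 97 * v.2.1 + 676 * v.2.2) := by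
    rw [cubicSeq, h3, h2]
    ext <;> ring
  have h5 : cubicSeq 12 45 52 (n + 1 + 1 + 1 + 1 + 1) = (-52 * u.1 - 624 * u.2.1 - 5044 * u.2.2 + 625 * v.1 + 4992 * v.2.1 + 34528 * v.2.2,
      47 * u.1 + 488 * u.2.1 + 3741 * u.2.2 - 488 * v.1 - 3695 * v.2.1 - 24888 * v.2.2,
      -12 * u.1 - 97 * u.2.1 - 676 * u.2.2 + 96 * v.1 + 664 * v.2.1 + 4273 * v.2.2) := by
    rw [cubicSeq, h4, h3]
    ext <;> ring
  have h6 : cubicSeq 12 45 52 (n + 1 + 1 + 1 + 1 + 1 + 1) = (-625 * u.1 - 4992 * u.2.1 - 34528 * u.2.2 + 4940 * v.1 + 33904 * v.2.1 + 217152 * v.2.2,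
      488 * u.1 + 3695 * u.2.1 + 24888 * u.2.2 - 3648 * v.1 - 24400 * v.2.1 - 154016 * v.2.2,
      -96 * u.1 - 664 * u.2.1 - 4273 * u.2.2 + 652 * v.1 + 4176 * v.2.1 + 25712 * v.2.2) := by
    rw [cubicSeq, h5, h4]
    ext <;> ring
  have h7 : cubicSeq 12 45 52 (n + 1 + 1 + 1 + 1 + 1 + 1 + 1) = (-4940 * u.1 - 33904 * u.2.1 - 217152 * u.2.2 + 33279 * v.1 + 212160 * v.2.1 + 1302496 * v.2.2,
      3648 * u.1 + 24400 * u.2.1 + 154016 * u.2.2 - 23912 * v.1 - 150321 * v.2.1 - 915000 * v.2.2,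
      -652 * u.1 - 4176 * u.2.1 - 25712 * u.2.2 + 4080 * v.1 + 25048 * v.2.1 + 150255 * v.2.2) := by
    rw [cubicSeq, h6, h5]
    ext <;> ring
  have h8 : cubicSeq 12 45 52 (n + 1 + 1 + 1 + 1 + 1 + 1 + 1 + 1) = (-33279 * u.1 - 212160 * u.2.1 - 1302496 * u.2.2 + 207220 * v.1 + 1268592 * v.2.1 + 7596108 * v.2.2,
      23912 * u.1 + 150321 * u.2.1 + 915000 * u.2.2 - 146673 * v.1 - 890600 * v.2.1 - 5304963 * v.2.2,
      -4080 * u.1 - 25048 * u.2.1 - 150255 * u.2.2 + 24396 * v.1 + 146079 * v.2.1 + 862348 * v.2.2) := by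
    rw [cubicSeq, h7, h6]
    ext <;> ring
  simp only [cubicForm, h2, h3, h4, h5, h6, h7, h8]
  ring

/-- Of the eight products `θ₁^±1 θ₂^±1 θ₃^±1` two inverse ones equal `1`, since `x ^ 2 - 2 * y - z -
4 = 0` for `(x, y, z) = (11, 38, 41)`. The order is thus `7` for arbitrary initial states. For the
actual sequence the two terms with root `1` have opposite signs and cancel, leaving order `6`. -/
lemma isRec_cubicForm_sym_seven :
    IsRec [-1, 40, -416, 1224, -1224, 416, -40] fun n =>
      cubicForm 11 38 41 (cubicSeq 11 38 41 n) := by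
  intro n
  simp only [List.cons_append, List.nil_append, lincomb]
  generalize hu : cubicSeq 11 38 41 n = u
  generalize hv : cubicSeq 11 38 41 (n + 1) = v
  have h2 : cubicSeq 11 38 41 (n + 1 + 1) = (-u.1 + 41 * v.2.2,
      -u.2.1 + v.1 - 38 * v.2.2,
      -u.2.2 + v.2.1 + 11 * v.2.2) := by
    rw [cubicSeq, hv, hu]
    ext <;> ring
  have h3 : cubicSeq 11 38 41 (n + 1 + 1 + 1) = (-41 * u.2.2 - v.1 + 41 * v.2.1 + 451 * v.2.2,
      -u.1 + 38 * u.2.2 - 39 * v.2.1 - 377 * v.2.2,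
      -u.2.1 - 11 * u.2.2 + v.1 + 11 * v.2.1 + 82 * v.2.2) := by
    rw [cubicSeq, h2, hv]
    ext <;> ring
  have h4 : cubicSeq 11 38 41 (n + 1 + 1 + 1 + 1) = (u.1 - 41 * u.2.1 - 451 * u.2.2 + 41 * v.1 + 451 * v.2.1 + 3321 * v.2.2,
      39 * u.2.1 + 377 * u.2.2 - 40 * v.1 - 377 * v.2.1 - 2627 * v.2.2,
      -u.1 - 11 * u.2.1 - 82 * u.2.2 + 11 * v.1 + 81 * v.2.1 + 514 * v.2.2) := by
    rw [cubicSeq, h3, h2]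
    ext <;> ring
  have h5 : cubicSeq 11 38 41 (n + 1 + 1 + 1 + 1 + 1) = (-41 * u.1 - 451 * u.2.1 - 3321 * u.2.2 + 452 * v.1 + 3280 * v.2.1 + 20623 * v.2.2,
      40 * u.1 + 377 * u.2.1 + 2627 * u.2.2 - 377 * v.1 - 2588 * v.2.1 - 15834 * v.2.2,
      -11 * u.1 - 81 * u.2.1 - 514 * u.2.2 + 80 * v.1 + 503 * v.2.1 + 2945 * v.2.2) := by
    rw [cubicSeq, h4, h3]
    ext <;> ring
  have h6 : cubicSeq 11 38 41 (n + 1 + 1 + 1 + 1 + 1 + 1) = (-452 * u.1 - 3280 * u.2.1 - 20623 * u.2.2 + 3239 * v.1 + 20172 * v.2.1 + 117424 * v.2.2,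
      377 * u.1 + 2588 * u.2.1 + 15834 * u.2.2 - 2548 * v.1 - 15457 * v.2.1 - 88660 * v.2.2,
      -80 * u.1 - 503 * u.2.1 - 2945 * u.2.2 + 492 * v.1 + 2864 * v.2.1 + 16047 * v.2.2) := by
    rw [cubicSeq, h5, h4]
    ext <;> ring
  have h7 : cubicSeq 11 38 41 (n + 1 + 1 + 1 + 1 + 1 + 1 + 1) = (-3239 * u.1 - 20172 * u.2.1 - 117424 * u.2.2 + 19720 * v.1 + 114144 * v.2.1 + 637304 * v.2.2,
      2548 * u.1 + 15457 * u.2.1 + 88660 * u.2.2 - 15080 * v.1 - 86072 * v.2.1 - 476528 * v.2.2,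
      -492 * u.1 - 2864 * u.2.1 - 16047 * u.2.2 + 2784 * v.1 + 15544 * v.2.1 + 84912 * v.2.2) := by
    rw [cubicSeq, h6, h5]
    ext <;> ring
  simp only [cubicForm, h2, h3, h4, h5, h6, h7]
  ring

lemma isRec_cubicForm_antisym_seven :
    IsRec [1, -71, 952, -3976, 6384, -3976, 952, -71] fun n =>
      cubicForm 13 54 71 (cubicSeq 13 54 71 n) := by
  intro n
  simp only [List.cons_append, List.nil_append, lincomb]
  generalize hu : cubicSeq 13 54 71 n = u
  generalize hv : cubicSeq 13 54 71 (n + 1) = v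
  have h2 : cubicSeq 13 54 71 (n + 1 + 1) = (-u.1 + 71 * v.2.2,
      -u.2.1 + v.1 - 54 * v.2.2,
      -u.2.2 + v.2.1 + 13 * v.2.2) := by
    rw [cubicSeq, hv, hu]
    ext <;> ring
  have h3 : cubicSeq 13 54 71 (n + 1 + 1 + 1) = (-71 * u.2.2 - v.1 + 71 * v.2.1 + 923 * v.2.2,
      -u.1 + 54 * u.2.2 - 55 * v.2.1 - 631 * v.2.2,
      -u.2.1 - 13 * u.2.2 + v.1 + 13 * v.2.1 + 114 * v.2.2) := by
    rw [cubicSeq, h2, hv]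
    ext <;> ring
  have h4 : cubicSeq 13 54 71 (n + 1 + 1 + 1 + 1) = (u.1 - 71 * u.2.1 - 923 * u.2.2 + 71 * v.1 + 923 * v.2.1 + 8023 * v.2.2,
      55 * u.2.1 + 631 * u.2.2 - 56 * v.1 - 631 * v.2.1 - 5179 * v.2.2,
      -u.1 - 13 * u.2.1 - 114 * u.2.2 + 13 * v.1 + 113 * v.2.1 + 838 * v.2.2) := by
    rw [cubicSeq, h3, h2]
    ext <;> ring
  have h5 : cubicSeq 13 54 71 (n + 1 + 1 + 1 + 1 + 1) = (-71 * u.1 - 923 * u.2.1 - 8023 * u.2.2 + 924 * v.1 + 7952 * v.2.1 + 58575 * v.2.2,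
      56 * u.1 + 631 * u.2.1 + 5179 * u.2.2 - 631 * v.1 - 5124 * v.2.1 - 36598 * v.2.2,
      -13 * u.1 - 113 * u.2.1 - 838 * u.2.2 + 112 * v.1 + 825 * v.2.1 + 5601 * v.2.2) := by
    rw [cubicSeq, h4, h3]
    ext <;> ring
  have h6 : cubicSeq 13 54 71 (n + 1 + 1 + 1 + 1 + 1 + 1) = (-924 * u.1 - 7952 * u.2.1 - 58575 * u.2.2 + 7881 * v.1 + 57652 * v.2.1 + 389648 * v.2.2,
      631 * u.1 + 5124 * u.2.1 + 36598 * u.2.2 - 5068 * v.1 - 35967 * v.2.1 - 238700 * v.2.2,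
      -112 * u.1 - 825 * u.2.1 - 5601 * u.2.2 + 812 * v.1 + 5488 * v.2.1 + 35377 * v.2.2) := by
    rw [cubicSeq, h5, h4]
    ext <;> ring
  have h7 : cubicSeq 13 54 71 (n + 1 + 1 + 1 + 1 + 1 + 1 + 1) = (-7881 * u.1 - 57652 * u.2.1 - 389648 * u.2.2 + 56728 * v.1 + 381696 * v.2.1 + 2453192 * v.2.2,
      5068 * u.1 + 35967 * u.2.1 + 238700 * u.2.2 - 35336 * v.1 - 233576 * v.2.1 - 1484112 * v.2.2,
      -812 * u.1 - 5488 * u.2.1 - 35377 * u.2.2 + 5376 * v.1 + 34552 * v.2.1 + 215600 * v.2.2) := by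
    rw [cubicSeq, h6, h5]
    ext <;> ring
  have h8 : cubicSeq 13 54 71 (n + 1 + 1 + 1 + 1 + 1 + 1 + 1 + 1) = (-56728 * u.1 - 381696 * u.2.1 - 2453192 * u.2.2 + 373815 * v.1 + 2395540 * v.2.1 + 14917952 * v.2.2,
      35336 * u.1 + 233576 * u.2.1 + 1484112 * u.2.2 - 228508 * v.1 - 1448145 * v.2.1 - 8950508 * v.2.2,
      -5376 * u.1 - 34552 * u.2.1 - 215600 * u.2.2 + 33740 * v.1 + 210112 * v.2.1 + 1283311 * v.2.2) := by
    rw [cubicSeq, h7, h6]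
    ext <;> ring
  simp only [cubicForm, h2, h3, h4, h5, h6, h7, h8]
  ring

/-! ### Generating functions -/

/-- The polynomial with the given list of integer coefficients, constant coefficient first. -/
noncomputable def ofCoeffs : List ℤ → ℚ[X]
  | [] => 0
  | c :: l => (c : ℚ[X]) + X * ofCoeffs l

lemma coeff_ofCoeffs (l : List ℤ) (n : ℕ) : (ofCoeffs l).coeff n = (l.getD n 0 : ℤ) := by
  induction l generalizing n with
  | nil => simp [ofCoeffs]
  | cons c l ih =>
    rw [ofCoeffs, coeff_add, ← C_eq_intCast, coeff_C]
    cases n with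
    | zero => simp
    | succ n => simp [coeff_X_mul, ih]

/-- The `n`-th coefficient of the product of the polynomial with coefficients `l` and `∑ sₙ tⁿ`. -/
def convCoeff : List ℤ → (ℕ → ℤ) → ℕ → ℤ
  | [], _, _ => 0
  | c :: l, s, n => c * s n + if n = 0 then 0 else convCoeff l s (n - 1)

lemma coeff_ofCoeffs_mul (l : List ℤ) (s : ℕ → ℤ) (n : ℕ) :
    PowerSeries.coeff n ((ofCoeffs l : ℚ⟦X⟧) * PowerSeries.mk fun n => (s n : ℚ)) =
      convCoeff l s n := by
  induction l generalizing n with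
  | nil => simp [ofCoeffs, convCoeff]
  | cons c l ih =>
    rw [ofCoeffs, ← C_eq_intCast, Polynomial.coe_add, Polynomial.coe_C, Polynomial.coe_mul,
      Polynomial.coe_X, add_mul, map_add, PowerSeries.coeff_C_mul, mul_assoc]
    cases n with
    | zero => simp [convCoeff]
    | succ n => simp [convCoeff, PowerSeries.coeff_succ_X_mul, ih]

/-- From the index `l.length` on, the convolution uses every coefficient. The denominator, read
backwards, is then the recurrence. -/
lemma convCoeff_eq_lincomb (l : List ℤ) (c : ℤ) (s : ℕ → ℤ) (n : ℕ) :
    convCoeff (c :: l) s (n + l.length) = lincomb (l.reverse ++ [c]) s n := by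
  induction l generalizing c with
  | nil => simp [convCoeff, lincomb]
  | cons d l ih =>
    rw [convCoeff, List.length_cons, if_neg (by omega), List.reverse_cons,
      show n + (l.length + 1) - 1 = n + l.length by omega, ih,
      lincomb_append_singleton (l.reverse ++ [d]), List.length_append, List.length_reverse,
      List.length_singleton, add_comm]

lemma convCoeff_congr (l : List ℤ) {s t : ℕ → ℤ} (n : ℕ) (h : ∀ i, i ≤ n → s i = t i) :
    convCoeff l s n = convCoeff l t n := by
  induction l generalizing n with
  | nil => rfl
  | cons c l ih =>
    rw [convCoeff, convCoeff, h n le_rfl]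
    split_ifs
    · rfl
    · rw [ih (n - 1) fun i hi => h i (by omega)]

/-- A recurrence and finitely many initial values determine a generating function. -/
lemma gridGF_eq_ratSeries {k : ℕ} {N D : ℚ[X]} {s t : ℕ → ℤ} {num den : List ℤ}
    (hN : N = ofCoeffs num) (hD : D = ofCoeffs (1 :: den))
    (hk : ∀ n, (numSpanningTrees k n : ℤ) = s n) (hs : IsRec den.reverse s)
    (ht : ∀ n, n < den.length → s n = t n) (hnum : num.length ≤ den.length)
    (h : ∀ n, n < den.length → convCoeff (1 :: den) t n = num.getD n 0) :
    gridGF k = ratSeries N D := by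
  have hD0 : PowerSeries.constantCoeff (D : ℚ⟦X⟧) ≠ 0 := by
    rw [← PowerSeries.coeff_zero_eq_constantCoeff_apply, Polynomial.coeff_coe, hD, coeff_ofCoeffs]
    simp
  have hF : gridGF k = PowerSeries.mk fun n => (s n : ℚ) := by
    ext n
    simp [gridGF, ← hk]
  rw [ratSeries, PowerSeries.eq_mul_inv_iff_mul_eq hD0, mul_comm, hF, hD, hN]
  ext n
  rw [coeff_ofCoeffs_mul, Polynomial.coeff_coe, coeff_ofCoeffs]
  congr 1
  -- Below the length of `den` the numerator is compared with the table; from there on the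
  -- recurrence gives zero, and so does the numerator.
  by_cases hn : n < den.length
  · rw [convCoeff_congr _ n fun i hi => ht i (by omega), h n hn]
  · obtain ⟨m, rfl⟩ := Nat.exists_eq_add_of_le (not_lt.1 hn)
    rw [add_comm, convCoeff_eq_lincomb, hs m, List.getD_eq_default _ _ (by omega)]

lemma numSpanningTrees_zero (k : ℕ) : numSpanningTrees k 0 = 0 := by
  have : IsEmpty {T : SimpleGraph (Fin k × Fin 0) // T ≤ gridGraph k 0 ∧ T.IsTree} :=
    ⟨fun T => by
      obtain ⟨v⟩ := T.2.2.connected.nonempty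
      exact v.2.elim0⟩
  exact Nat.card_of_isEmpty

/-- The number of spanning trees of the grid, from a splitting of the path Laplacian into two
blocks on the complement of the constants. -/
lemma numSpanningTrees_eq_mul {a b k : ℕ} (hk : 0 < k) (e : Fin 1 ⊕ (Fin (a + 1) ⊕ Fin b) ≃ Fin k)
    (P Q : Matrix (Fin k) (Fin k) ℤ) {c : ℤ} (hc : c ≠ 0) (hQ : P * Q = c • 1)
    (A : Matrix (Fin (a + 1)) (Fin (a + 1)) ℤ) (B : Matrix (Fin b) (Fin b) ℤ)
    (hAB : A.det * B.det = k)
    (hL : pathLap k * P = P * (fromBlocks 0 0 0 (fromBlocks A 0 0 B)).submatrix e.symm e.symm)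
    (hJ : onesMatrix k * P =
      P * (fromBlocks (k : Matrix (Fin 1) (Fin 1) ℤ) 0 0 0).submatrix e.symm e.symm) (n : ℕ) :
    (numSpanningTrees k n : ℤ) = (chebU A n).det * (chebU B n).det := by
  cases n with
  -- The first block has size `a + 1`, so the determinant of its zero matrix is `0`, matching the
  -- empty grid even when the second block is empty.
  | zero => simp [numSpanningTrees_zero, chebU]
  | succ n =>
    have h := numSpanningTrees_eq_det hk e (P.submatrix e e) ?_ (fromBlocks A 0 0 B) ?_ ?_ ?_ n
    · rw [h, chebU_fromBlocks, det_fromBlocks_zero₂₁]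
    · rw [det_submatrix_equiv_self]
      intro h
      have h1 := congrArg det hQ
      rw [det_mul, h, zero_mul, det_smul, det_one, mul_one] at h1
      exact pow_ne_zero _ hc h1.symm
    · rw [det_fromBlocks_zero₂₁, hAB]
    · rw [submatrix_mul_equiv, hL, ← submatrix_mul_equiv _ _ e e e]
      simp
    · rw [submatrix_mul_equiv, hJ, ← submatrix_mul_equiv _ _ e e e]
      simp

/-- Checking the recurrences along the tables for `N` steps certifies enough values for the
rectangle test, which then involves only explicit integers. -/
lemma IsRec.mul_of_tables {c c' d : List ℤ} {a b : ℕ → ℤ} (A B : List ℤ) (N : ℕ) (ha : IsRec c a)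
    (hb : IsRec c' b) (hA : ∀ n, n < c.length → a n = A.getD n 0)
    (hB : ∀ n, n < c'.length → b n = B.getD n 0)
    (hA' : ∀ n, n < N → lincomb (c ++ [1]) (fun i => A.getD i 0) n = 0)
    (hB' : ∀ n, n < N → lincomb (c' ++ [1]) (fun i => B.getD i 0) n = 0)
    (hc : c.length + d.length ≤ N + c'.length) (hc' : c'.length + d.length ≤ N + c.length)
    (h : ∀ n, n < c.length → ∀ m, m < c'.length →
      lincomb₂ (d ++ [1]) (fun i => A.getD i 0) (fun i => B.getD i 0) n m = 0) :
    IsRec d (fun n => a n * b n) ∧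
      ∀ n, n < d.length → a n * b n = A.getD n 0 * B.getD n 0 := by
  have h1 : ∀ n, n < N + c.length → a n = A.getD n 0 :=
    ha.eq_of_initial (fun n hn => hA' n (by omega)) hA
  have h2 : ∀ n, n < N + c'.length → b n = B.getD n 0 :=
    hb.eq_of_initial (fun n hn => hB' n (by omega)) hB
  refine ⟨ha.mul hb fun n hn m hm => ?_, fun n hn => by rw [h1 n (by omega), h2 n (by omega)]⟩
  rw [← h n hn m hm]
  exact lincomb₂_congr _ (N := N + min c.length c'.length) n m (fun i hi => h1 i (by omega))
    (fun i hi => h2 i (by omega)) (by simp; omega) (by simp; omega)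

lemma isRec_one : IsRec [-1] fun _ => 1 := fun n => by simp [lincomb]

/-! ### The cases `k = 2, …, 7` -/

/-- The vertices of a column, split as needed for the decomposition of the path Laplacian. -/
def blockEquiv (a b : ℕ) : Fin 1 ⊕ (Fin a ⊕ Fin b) ≃ Fin (1 + (a + b)) :=
  (Equiv.sumCongr (Equiv.refl _) finSumFinEquiv).trans finSumFinEquiv

/-- The coefficients of the numerator for `k = 2`. -/
def numCoeffsTwo : List ℤ :=
  [0, 1]

/-- The coefficients of the denominator for `k = 2`, without the constant one. -/
def denCoeffsTwo : List ℤ :=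
  [-4, 1]

/-- The values of the symmetric factor for `k = 2`. -/
def symValuesTwo : List ℤ :=
  [0, 1, 4, 15, 56]

/-- The values of the antisymmetric factor for `k = 2`. -/
def antisymValuesTwo : List ℤ :=
  [1, 1, 1, 1]

/-- Here and for larger `k`, the columns of the first matrix are the constant vector, then sums and
then differences of the edge vectors `e_i - e_(i+1)` and their mirror edges (a middle edge is taken
once, among the sums). Symmetry refers to edges, so the symmetric block acts on vertex vectors that
are odd under reflection. The second matrix is a multiple of the inverse. -/
lemma numSpanningTrees_two (n : ℕ) : (numSpanningTrees 2 n : ℤ) =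
    (chebU (!![2] : Matrix (Fin 1) (Fin 1) ℤ) n).det *
      (chebU (!![] : Matrix (Fin 0) (Fin 0) ℤ) n).det :=
  numSpanningTrees_eq_mul (k := 2) (by norm_num) (blockEquiv 1 0)
    !![1, 1; 1, -1]
    !![1, 1; 1, -1]
    (c := 2) (by norm_num) (by decide +kernel) _ _ (by decide +kernel) (by decide +kernel)
    (by decide +kernel) n

theorem gridGF_two : gridGF 2 = ratSeries gridNum2 gridDen2 := by
  have hA : ∀ n, (chebU (!![2] : Matrix (Fin 1) (Fin 1) ℤ) n).det = (chebU (2 : ℤ)) n :=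
    det_chebU_fin_one 2
  have hB : ∀ n, (chebU (!![] : Matrix (Fin 0) (Fin 0) ℤ) n).det = (fun _ => 1) n :=
    fun _ => det_isEmpty
  obtain ⟨hr, ht⟩ := IsRec.mul_of_tables (c' := [-1])
    (d := denCoeffsTwo.reverse) symValuesTwo
    antisymValuesTwo 3 (isRec_chebU 2) (isRec_one) (by decide +kernel)
    (by decide +kernel) (by decide +kernel) (by decide +kernel) (by decide +kernel)
    (by decide +kernel) (by decide +kernel)
  refine gridGF_eq_ratSeries (num := numCoeffsTwo) (den := denCoeffsTwo) ?_ ?_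
    (fun n => (numSpanningTrees_two n).trans (by rw [hA, hB])) hr
    (fun n hn => ht n (by rwa [List.length_reverse])) (by decide +kernel) (by decide +kernel)
  · simp only [gridNum2, ofCoeffs, numCoeffsTwo]
    push_cast
    ring
  · simp only [gridDen2, ofCoeffs, denCoeffsTwo]
    push_cast
    ring

/-- The coefficients of the numerator for `k = 3`. -/
def numCoeffsThree : List ℤ :=
  [0, 1, 0, -1]

/-- The coefficients of the denominator for `k = 3`, without the constant one. -/
def denCoeffsThree : List ℤ :=
  [-15, 32, -15, 1]

/-- The values of the symmetric factor for `k = 3`. -/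
def symValuesThree : List ℤ :=
  [0, 1, 3, 8, 21, 55]

/-- The values of the antisymmetric factor for `k = 3`. -/
def antisymValuesThree : List ℤ :=
  [0, 1, 5, 24, 115, 551]

lemma numSpanningTrees_three (n : ℕ) : (numSpanningTrees 3 n : ℤ) =
    (chebU (!![1] : Matrix (Fin 1) (Fin 1) ℤ) n).det *
      (chebU (!![3] : Matrix (Fin 1) (Fin 1) ℤ) n).det :=
  numSpanningTrees_eq_mul (k := 3) (by norm_num) (blockEquiv 1 1)
    !![1, 1, 1; 1, 0, -2; 1, -1, 1]
    !![2, 2, 2; 3, 0, -3; 1, -2, 1]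
    (c := 6) (by norm_num) (by decide +kernel) _ _ (by decide +kernel) (by decide +kernel)
    (by decide +kernel) n

theorem gridGF_three : gridGF 3 = ratSeries gridNum3 gridDen3 := by
  have hA : ∀ n, (chebU (!![1] : Matrix (Fin 1) (Fin 1) ℤ) n).det = (chebU (1 : ℤ)) n :=
    det_chebU_fin_one 1
  have hB : ∀ n, (chebU (!![3] : Matrix (Fin 1) (Fin 1) ℤ) n).det = (chebU (3 : ℤ)) n :=
    det_chebU_fin_one 3
  obtain ⟨hr, ht⟩ := IsRec.mul_of_tables (c' := [1, -5])
    (d := denCoeffsThree.reverse) symValuesThree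
    antisymValuesThree 4 (isRec_chebU 1) (isRec_chebU 3) (by decide +kernel)
    (by decide +kernel) (by decide +kernel) (by decide +kernel) (by decide +kernel)
    (by decide +kernel) (by decide +kernel)
  refine gridGF_eq_ratSeries (num := numCoeffsThree) (den := denCoeffsThree) ?_ ?_
    (fun n => (numSpanningTrees_three n).trans (by rw [hA, hB])) hr
    (fun n hn => ht n (by rwa [List.length_reverse])) (by decide +kernel) (by decide +kernel)
  · simp only [gridNum3, ofCoeffs, numCoeffsThree]
    push_cast
    ring
  · simp only [gridDen3, ofCoeffs, denCoeffsThree]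
    push_cast
    ring

/-- The coefficients of the numerator for `k = 4`. -/
def numCoeffsFour : List ℤ :=
  [0, 1, 0, -49, 112, -49, 0, 1]

/-- The coefficients of the denominator for `k = 4`, without the constant one. -/
def denCoeffsFour : List ℤ :=
  [-56, 672, -2632, 4094, -2632, 672, -56, 1]

/-- The values of the symmetric factor for `k = 4`. -/
def symValuesFour : List ℤ :=
  [0, 1, 14, 161, 1792, 19809, 218638, 2412353, 26614784, 293628097, 3239445006, 35739069409,
  394290020096, 4349990523425]

/-- The values of the antisymmetric factor for `k = 4`. -/
def antisymValuesFour : List ℤ :=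
  [0, 1, 4, 15, 56, 209, 780, 2911, 10864, 40545, 151316, 564719]

lemma numSpanningTrees_four (n : ℕ) : (numSpanningTrees 4 n : ℤ) =
    (chebU (!![2, -1; -2, 2] : Matrix (Fin 2) (Fin 2) ℤ) n).det *
      (chebU (!![2] : Matrix (Fin 1) (Fin 1) ℤ) n).det :=
  numSpanningTrees_eq_mul (k := 4) (by norm_num) (blockEquiv 2 1)
    !![1, 1, 0, 1; 1, -1, 1, -1; 1, 1, -1, -1; 1, -1, 0, 1]
    !![1, 1, 1, 1; 2, 0, 0, -2; 2, 2, -2, -2; 1, -1, -1, 1]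
    (c := 4) (by norm_num) (by decide +kernel) _ _ (by decide +kernel) (by decide +kernel)
    (by decide +kernel) n

theorem gridGF_four : gridGF 4 = ratSeries gridNum4 gridDen4 := by
  have hA : ∀ n, (chebU (!![2, -1; -2, 2] : Matrix (Fin 2) (Fin 2) ℤ) n).det = (fun n => quadForm 8 14 (quadSeq 8 14 n)) n :=
    det_chebU_fin_two (2) (-1) (-2) (2)
  have hB : ∀ n, (chebU (!![2] : Matrix (Fin 1) (Fin 1) ℤ) n).det = (chebU (2 : ℤ)) n :=
    det_chebU_fin_one 2
  obtain ⟨hr, ht⟩ := IsRec.mul_of_tables (c' := [1, -4])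
    (d := denCoeffsFour.reverse) symValuesFour
    antisymValuesFour 10 (isRec_quadForm 8 14) (isRec_chebU 2) (by decide +kernel)
    (by decide +kernel) (by decide +kernel) (by decide +kernel) (by decide +kernel)
    (by decide +kernel) (by decide +kernel)
  refine gridGF_eq_ratSeries (num := numCoeffsFour) (den := denCoeffsFour) ?_ ?_
    (fun n => (numSpanningTrees_four n).trans (by rw [hA, hB])) hr
    (fun n hn => ht n (by rwa [List.length_reverse])) (by decide +kernel) (by decide +kernel)
  · simp only [gridNum4, ofCoeffs, numCoeffsFour]
    push_cast
    ring
  · simp only [gridDen4, ofCoeffs, denCoeffsFour]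
    push_cast
    ring

/-- The coefficients of the numerator for `k = 5`. -/
def numCoeffsFive : List ℤ :=
  [0, 1, 0, -1440, 26752, -185889, 574750, -708928, 0, 708928, -574750, 185889, -26752, 1440, 0,
  -1]

/-- The coefficients of the denominator for `k = 5`, without the constant one. -/
def denCoeffsFive : List ℤ :=
  [-209, 11936, -274208, 3112032, -19456019, 70651107, -152325888, 196664896, -152325888,
  70651107, -19456019, 3112032, -274208, 11936, -209, 1]

/-- The values of the symmetric factor for `k = 5`. -/
def symValuesFive : List ℤ :=
  [0, 1, 11, 95, 781, 6336, 51205, 413351, 3335651, 26915305, 217172736, 1752296281, 14138673395,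
  114079985111, 920471087701, 7426955448000, 59925473898301, 483517428660911, 3901330906652795,
  31478457514091281]

/-- The values of the antisymmetric factor for `k = 5`. -/
def antisymValuesFive : List ℤ :=
  [0, 1, 19, 319, 5301, 88000, 1460701, 24245719, 402446619, 6680076601, 110880352000,
  1840465787401, 30549274537419, 507077165538919, 8416803858813901, 139707705280792000,
  2318961358994380101, 38491662100532675119, 638910193787827477219, 10605056093962494817201]

/-- For odd `k` the two middle edges are mirror images; their coupling `-1` changes the last
diagonal entry `2` to `1` on symmetric and to `3` on antisymmetric combinations. -/
lemma numSpanningTrees_five (n : ℕ) : (numSpanningTrees 5 n : ℤ) =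
    (chebU (!![2, -1; -1, 1] : Matrix (Fin 2) (Fin 2) ℤ) n).det *
      (chebU (!![2, -1; -1, 3] : Matrix (Fin 2) (Fin 2) ℤ) n).det :=
  numSpanningTrees_eq_mul (k := 5) (by norm_num) (blockEquiv 2 2)
    !![1, 1, 0, 1, 0; 1, -1, 1, -1, 1; 1, 0, 0, 0, -2; 1, 1, -1, -1, 1; 1, -1, 0, 1, 0]
    !![2, 2, 2, 2, 2; 5, 0, 0, 0, -5; 5, 5, 0, -5, -5; 3, -2, -2, -2, 3; 1, 1, -4, 1, 1]
    (c := 10) (by norm_num) (by decide +kernel) _ _ (by decide +kernel) (by decide +kernel)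
    (by decide +kernel) n

theorem gridGF_five : gridGF 5 = ratSeries gridNum5 gridDen5 := by
  have hA : ∀ n, (chebU (!![2, -1; -1, 1] : Matrix (Fin 2) (Fin 2) ℤ) n).det = (fun n => quadForm 7 11 (quadSeq 7 11 n)) n :=
    det_chebU_fin_two (2) (-1) (-1) (1)
  have hB : ∀ n, (chebU (!![2, -1; -1, 3] : Matrix (Fin 2) (Fin 2) ℤ) n).det = (fun n => quadForm 9 19 (quadSeq 9 19 n)) n :=
    det_chebU_fin_two (2) (-1) (-1) (3)
  obtain ⟨hr, ht⟩ := IsRec.mul_of_tables (c' := [1, -19, 41, -19])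
    (d := denCoeffsFive.reverse) symValuesFive
    antisymValuesFive 16 (isRec_quadForm 7 11) (isRec_quadForm 9 19) (by decide +kernel)
    (by decide +kernel) (by decide +kernel) (by decide +kernel) (by decide +kernel)
    (by decide +kernel) (by decide +kernel)
  refine gridGF_eq_ratSeries (num := numCoeffsFive) (den := denCoeffsFive) ?_ ?_
    (fun n => (numSpanningTrees_five n).trans (by rw [hA, hB])) hr
    (fun n hn => ht n (by rwa [List.length_reverse])) (by decide +kernel) (by decide +kernel)
  · simp only [gridNum5, ofCoeffs, numCoeffsFive]
    push_cast
    ring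
  · simp only [gridDen5, ofCoeffs, denCoeffsFive]
    push_cast
    ring

/-- The coefficients of the numerator for `k = 6`. -/
def numCoeffsSix : List ℤ :=
  [0, 1, 0, -33359, 3642600, -173371343, 4540320720, -70164186331, 634164906960, -2844883304348,
  -1842793012320, 104844096982372, -678752492380560, 2471590551535210, -5926092273213840,
  9869538714631398, -11674018886109840, 9869538714631398, -5926092273213840, 2471590551535210,
  -678752492380560, 104844096982372, -1842793012320, -2844883304348, 634164906960, -70164186331,
  4540320720, -173371343, 3642600, -33359, 0, 1]

/-- The coefficients of the denominator for `k = 6`, without the constant one. -/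
def denCoeffsSix : List ℤ :=
  [-780, 194881, -22377420, 1419219792, -55284715980, 1410775106597, -24574215822780,
  300429297446885, -2629946465331120, 16741727755133760, -78475174345180080, 273689714665707178,
  -716370537293731320, 1417056251105102122, -2129255507292156360, 2437932520099475424,
  -2129255507292156360, 1417056251105102122, -716370537293731320, 273689714665707178,
  -78475174345180080, 16741727755133760, -2629946465331120, 300429297446885, -24574215822780,
  1410775106597, -55284715980, 1419219792, -22377420, 194881, -780, 1]

/-- The values of the symmetric factor for `k = 6`. -/
def symValuesSix : List ℤ :=
  [0, 1, 52, 1980, 70616, 2468081, 85662720, 2965869439, 102595585456, 3547870601220,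
  122675403382532, 4241597831717807, 146654405999861760, 5070589532000717425,
  175315766427506715244, 6061543118985318911100, 209577819334642341276512,
  7246151293152894470230049, 250535610487719055231349760, 8662266198155243954205423919,
  299497764957317325828771157816, 10355132136534827209832415886020,
  358028586705042839328489516068156, 12378834686393134336925699181569183,
  427998081362561809525607182053212160, 14798029239937171027603723915075915681,
  511641708035199237885451372798954363300, 17690006767513937905932469267739934604860,
  611631801160371007999696491463923739342568, 21147163203889601373378311191386206251746833,
  731162949217907346568324540633260593408486400, 25279951412616488487196075253666651207036095519,
  874054058822085711006302155237836991051492693696,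
  30220410050395962713643693321353730603382822115460,
  1044870365163498979516539398564770318208127533442164,
  36126382076758023904404383230869252728822356563441359,
  1249069286936548758269240777768325905788132551627202560,
  43186557686658558089542887430786232892808213029632717713,
  1493174785681709831340588046391049800327957738999125411804,
  51626502782934052717595599715453371210443652909435695541500,
  1784985800158321791794887697852890215361195720304223336991856,
  61715865592586372191192395981619699902802131377811726046887617,
  2133825415028150576613781035084962175666484585947275646117381120,
  73776991671441682131522895512489430705902796646353090145977024591]

/-- The values of the antisymmetric factor for `k = 6`. -/
def antisymValuesSix : List ℤ :=
  [0, 1, 15, 192, 2415, 30305, 380160, 4768673, 59817135, 750331584, 9411975375, 118061508289,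
  1480934568960, 18576479568193, 233018797965135, 2922930580320960, 36664523428884015,
  459910778352898337, 5769007865476035840, 72365017995700730081, 907729015392142395375,
  11386329862223500207296, 142827325702873981372815, 1791590900164844149159297,
  22473276298898655194173440, 281899259233885701359889025, 3536075083120298342440801935,
  44355657504903447676859022528, 556386475525911555059983837935, 6979175319719333589675520988129,
  87545061366451265500023776544000, 1098143751741134077508962875086369,
  13774845555710834758923755107871535, 172788280025123280552480195742481088,
  2167413753808853055898777192035078735, 27187505885912772248108638980509772865,
  341033397521629424306396993743553418240, 4277839192502340325214407636461772241857,
  53660164341377846031077141554648485758415, 673099924417531328651643925220123366137536]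

lemma numSpanningTrees_six (n : ℕ) : (numSpanningTrees 6 n : ℤ) =
    (chebU (!![2, -1, 0; -1, 2, -1; 0, -2, 2] : Matrix (Fin 3) (Fin 3) ℤ) n).det *
      (chebU (!![2, -1; -1, 2] : Matrix (Fin 2) (Fin 2) ℤ) n).det :=
  numSpanningTrees_eq_mul (k := 6) (by norm_num) (blockEquiv 3 2)
    !![1, 1, 0, 0, 1, 0; 1, -1, 1, 0, -1, 1; 1, 0, -1, 1, 0, -1; 1, 0, 1, -1, 0, -1; 1, 1, -1, 0, -1, 1; 1, -1, 0, 0, 1, 0]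
    !![1, 1, 1, 1, 1, 1; 3, 0, 0, 0, 0, -3; 3, 3, 0, 0, -3, -3; 3, 3, 3, -3, -3, -3; 2, -1, -1, -1, -1, 2; 1, 1, -2, -2, 1, 1]
    (c := 6) (by norm_num) (by decide +kernel) _ _ (by decide +kernel) (by decide +kernel)
    (by decide +kernel) n

theorem gridGF_six : gridGF 6 = ratSeries gridNum6 gridDen6 := by
  have hA : ∀ n, (chebU (!![2, -1, 0; -1, 2, -1; 0, -2, 2] : Matrix (Fin 3) (Fin 3) ℤ) n).det = (fun n => cubicForm 12 45 52 (cubicSeq 12 45 52 n)) n :=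
    det_chebU_fin_three (B := !![2, -1, 0; -1, 2, -1; 0, -2, 2]) (M := !![4, -1, 0; -1, 4, -1; 0, -2, 4]) (x := 12) (y := 45) (z := 52) (by decide) (by decide +kernel) (by intro p q r; rw [one_fin_three]; simp [sq, det_fin_three, cubicForm]; ring)
  have hB : ∀ n, (chebU (!![2, -1; -1, 2] : Matrix (Fin 2) (Fin 2) ℤ) n).det = (fun n => quadForm 8 15 (quadSeq 8 15 n)) n :=
    det_chebU_fin_two (2) (-1) (-1) (2)
  obtain ⟨hr, ht⟩ := IsRec.mul_of_tables (c' := [1, -15, 32, -15])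
    (d := denCoeffsSix.reverse) symValuesSix
    antisymValuesSix 36 (isRec_cubicForm_sym_six) (isRec_quadForm 8 15) (by decide +kernel)
    (by decide +kernel) (by decide +kernel) (by decide +kernel) (by decide +kernel)
    (by decide +kernel) (by decide +kernel)
  refine gridGF_eq_ratSeries (num := numCoeffsSix) (den := denCoeffsSix) ?_ ?_
    (fun n => (numSpanningTrees_six n).trans (by rw [hA, hB])) hr
    (fun n hn => ht n (by rwa [List.length_reverse])) (by decide +kernel) (by decide +kernel)
  · simp only [gridNum6, ofCoeffs, numCoeffsSix]
    push_cast
    ring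
  · simp only [gridDen6, ofCoeffs, denCoeffsSix]
    push_cast
    ring

/-- The coefficients of the numerator for `k = 7`. -/
def numCoeffsSeven : List ℤ :=
  [0, 1, 142, -661245, 279917500, -53184503243, 5570891154842, -341638600598298,
  11886702497030032, -164458937576610742, -4371158470492451828, 288737344956855301342,
  -7736513993329973661368, 131582338768322853956994, -1573202877300834187134466,
  13805721749199518460916737, -90975567796174070740787232, 455915282590547643587452175,
  -1747901867578637315747826286, 5126323837327170557921412877, -11416779122947828869806142972,
  18924703166237080216745900796, -22194247945745188489023284104, 15563815847174688069871470516, 0,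
  -15563815847174688069871470516, 22194247945745188489023284104, -18924703166237080216745900796,
  11416779122947828869806142972, -5126323837327170557921412877, 1747901867578637315747826286,
  -455915282590547643587452175, 90975567796174070740787232, -13805721749199518460916737,
  1573202877300834187134466, -131582338768322853956994, 7736513993329973661368,
  -288737344956855301342, 4371158470492451828, 164458937576610742, -11886702497030032,
  341638600598298, -5570891154842, 53184503243, -279917500, 661245, -142, -1]

/-- The coefficients of the denominator for `k = 7`, without the constant one. -/
def denCoeffsSeven : List ℤ :=
  [-2769, 2630641, -1195782497, 305993127089, -48551559344145, 5083730101530753,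
  -366971376492201338, 18871718211768417242, -709234610141846974874, 19874722637854592209338,
  -422023241997789381263002, 6880098547452856483997402, -87057778313447181201990522,
  862879164715733847737203343, -6750900711491569851736413311, 41958615314622858303912597215,
  -208258356862493902206466194607, 828959040281722890327985220255,
  -2654944041424536277948746010303, 6859440538554030239641036025103,
  -14324708604336971207868317957868, 24214587194571650834572683444012,
  -33166490975387358866518005011884, 36830850383375837481096026357868,
  -33166490975387358866518005011884, 24214587194571650834572683444012,
  -14324708604336971207868317957868, 6859440538554030239641036025103,
  -2654944041424536277948746010303, 828959040281722890327985220255,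
  -208258356862493902206466194607, 41958615314622858303912597215, -6750900711491569851736413311,
  862879164715733847737203343, -87057778313447181201990522, 6880098547452856483997402,
  -422023241997789381263002, 19874722637854592209338, -709234610141846974874,
  18871718211768417242, -366971376492201338, 5083730101530753, -48551559344145, 305993127089,
  -1195782497, 2630641, -2769, 1]

/-- The values of the symmetric factor for `k = 7`. -/
def symValuesSeven : List ℤ :=
  [0, 1, 41, 1183, 31529, 817991, 21001799, 536948224, 13704300553, 349519610713, 8911652846951,
  227191499132401, 5791672851807479, 147640981046478543, 3763622719883603968,
  95940879136187583953, 2445685822753246301257, 62344389094970498108207,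
  1589256410595418296414137, 40512638138500187085447911, 1032730632545960228058586519,
  26325921721969602022765156864, 671088982508991539769560169817, 17107109328511967957407853447417,
  436087012059746356664964137228791, 11116540985159060438161782801370241,
  283378041607739251943568036986657559, 7223750136439017321487892179927639711,
  184144705552062006827721782762957668352, 4694136970669619918287171287327709741729,
  119660903815876939356076819275165496104809, 3050343863304994652617377152048959878653375,
  77758042833350505522988217115663958537535561, 1982174304348558446264441043200814712761131911,
  50528727700098534249891126691103616071943392743,
  1288056412288930045229008905085759239228524230144,
  32834575433715945294040720263169142454399585110441,
  837004756644565928756388567003433737044078376699289,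
  21336562248532773206971462951976708767887689615112839,
  543902391200907278462007018561983965347901734958733073,
  13864923866749316359444069637191020705152248260472293943,
  353438626012119054222242162842227188883110465990257114991,
  9009704168438556160870598005928343630789691954604228202496,
  229671471165111671878226120307055238062401346449595170848369,
  5854685534729214464112418752716575115202030612027941127803273,
  149245104481981564009539435072525224036247358287244202390385743,
  3804491476051205999703663714506456929741873395199836763274628313,
  96982446704600324999222865010685058459268814874154501797017398567,
  2472234470235424754861167124632531702565008659893067995556053444407,
  63021128910437290621248333056910332010294950856725897963511773307392,
  1606507286005013634810260376602268882554145117005984501310598309399801,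
  40952386994764905153284659092833448016058916978784658870317462557976889,
  1043940488274732794039717190722737392875060849914119384714788637364109079,
  26611678171497113891845848463903210626479982739348843774342231191434644897,
  678373358498348199772432821103226187290117075326976001484989076806750272087,
  17292799445215865446302314275104825691570822374558419634116522278577735872831]

/-- The values of the antisymmetric factor for `k = 7`. -/
def antisymValuesSeven : List ℤ :=
  [0, 1, 71, 4031, 222727, 12251959, 673430953, 37009842688, 2033900423143, 111773786497129,
  6142566091826569, 337566730934529713, 18551089642641882521, 1019481167308519662319,
  56025919198304228339712, 3078922614789253858179569, 169203193863724628162828071,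
  9298616560210340662114099759, 511008497885353414354855007639, 28082638231194653611604667910103,
  1543290519213740189481460617284153, 84812032512291319247288221184185856,
  4660872835874483170513077236015212151, 256139782866827828194372724320708838153,
  14076245089136027407096961957651008023833, 773564627844021433233709794644566459595041,
  42511495761984359297098959987531373453742713, 2336233078492850151240653475260933176659087071,
  128388448799887885279608902397635892918276292608,
  7055628968268578365546085613630245104221176883937,
  387744385131275107901593908934740775825790388401927,
  21308618817256883137369450639386412106638315517978783,
  1171022078747647317847627474989643415777410511646738727,
  64353899268399010308648498119490549035836406380706311543,
  3536589468472109407839984171948763448236115191971980000713,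
  194354424684404935726474666008493593278978356531663678331392,
  10680810631584315801517804164317416223653511388350966722985479,
  586967422702151353152456858155895278458063697842765809667458217,
  32256985653765941887113148200866930452397993475563055042815938729,
  1772693139726863584864465029014409220636027060656483074176108801937,
  97418928146741184391456453063243887930765402599086388733399812157017,
  5353688886460185187755453444664583658731151125251585210900548895351759,
  294213714298252478679020203322914539748941802123833498384568288753373184,
  16168610376313372500836555846950833692514696624162944580795669734065156817,
  888551242842527206267986762808986379164763620752489560543372643200012439527,
  48830622594111892494189499869280561654772909668269163122829486016534161113871,
  2683502749150022317893422897194070446951970801506570083968850451352002779865271,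
  147472766516887767665078622890970779049499903550050555603326294815223399079719959,
  8104413856491507150501356281981716842329247980228652041588108692700362955013240921,
  445380699830907814946833757220566292356861815632735120829909496805724327222264483328,
  24476041240537440201509434300461223705495507757527368501330422969143332144845098708631,
  1345088808374349315925061037160952713150691152666307414641982038015925829517812115830089,
  73919793018546145657304254102540560839175347318441770541681100685074548277461865270456377,
  4062286271274951690380857906891357570207528782421966849339789494699032747612161347897930241,
  223244263490410880442666170754475794428536585833482684065964432440388687376678901708523716921,
  12268461120967308180169679012900647722608491013363783454396655251392317107198930016797767352767,
  674217271805291292633082085597071444083264615813776393695371062230656793377988041535746815557632]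

lemma numSpanningTrees_seven (n : ℕ) : (numSpanningTrees 7 n : ℤ) =
    (chebU (!![2, -1, 0; -1, 2, -1; 0, -1, 1] : Matrix (Fin 3) (Fin 3) ℤ) n).det *
      (chebU (!![2, -1, 0; -1, 2, -1; 0, -1, 3] : Matrix (Fin 3) (Fin 3) ℤ) n).det :=
  numSpanningTrees_eq_mul (k := 7) (by norm_num) (blockEquiv 3 3)
    !![1, 1, 0, 0, 1, 0, 0; 1, -1, 1, 0, -1, 1, 0; 1, 0, -1, 1, 0, -1, 1; 1, 0, 0, 0, 0, 0, -2; 1, 0, 1, -1, 0, -1, 1; 1, 1, -1, 0, -1, 1, 0; 1, -1, 0, 0, 1, 0, 0]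
    !![2, 2, 2, 2, 2, 2, 2; 7, 0, 0, 0, 0, 0, -7; 7, 7, 0, 0, 0, -7, -7; 7, 7, 7, 0, -7, -7, -7; 5, -2, -2, -2, -2, -2, 5; 3, 3, -4, -4, -4, 3, 3; 1, 1, 1, -6, 1, 1, 1]
    (c := 14) (by norm_num) (by decide +kernel) _ _ (by decide +kernel) (by decide +kernel)
    (by decide +kernel) n

theorem gridGF_seven : gridGF 7 = ratSeries gridNum7 gridDen7 := by
  have hA : ∀ n, (chebU (!![2, -1, 0; -1, 2, -1; 0, -1, 1] : Matrix (Fin 3) (Fin 3) ℤ) n).det = (fun n => cubicForm 11 38 41 (cubicSeq 11 38 41 n)) n :=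
    det_chebU_fin_three (B := !![2, -1, 0; -1, 2, -1; 0, -1, 1]) (M := !![4, -1, 0; -1, 4, -1; 0, -1, 3]) (x := 11) (y := 38) (z := 41) (by decide) (by decide +kernel) (by intro p q r; rw [one_fin_three]; simp [sq, det_fin_three, cubicForm]; ring)
  have hB : ∀ n, (chebU (!![2, -1, 0; -1, 2, -1; 0, -1, 3] : Matrix (Fin 3) (Fin 3) ℤ) n).det = (fun n => cubicForm 13 54 71 (cubicSeq 13 54 71 n)) n :=
    det_chebU_fin_three (B := !![2, -1, 0; -1, 2, -1; 0, -1, 3]) (M := !![4, -1, 0; -1, 4, -1; 0, -1, 5]) (x := 13) (y := 54) (z := 71) (by decide) (by decide +kernel) (by intro p q r; rw [one_fin_three]; simp [sq, det_fin_three, cubicForm]; ring)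
  -- The order `48` is `6 * 8`, less than `7 * 8`, because the symmetric sequence has no
  -- contribution from the root `1`.
  obtain ⟨hr, ht⟩ := IsRec.mul_of_tables (c' := [1, -71, 952, -3976, 6384, -3976, 952, -71])
    (d := denCoeffsSeven.reverse) symValuesSeven
    antisymValuesSeven 49 (isRec_cubicForm_sym_seven) (isRec_cubicForm_antisym_seven) (by decide +kernel)
    (by decide +kernel) (by decide +kernel) (by decide +kernel) (by decide +kernel)
    (by decide +kernel) (by decide +kernel)
  refine gridGF_eq_ratSeries (num := numCoeffsSeven) (den := denCoeffsSeven) ?_ ?_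
    (fun n => (numSpanningTrees_seven n).trans (by rw [hA, hB])) hr
    (fun n hn => ht n (by rwa [List.length_reverse])) (by decide +kernel) (by decide +kernel)
  · simp only [gridNum7, ofCoeffs, numCoeffsSeven]
    push_cast
    ring
  · simp only [gridDen7, ofCoeffs, denCoeffsSeven]
    push_cast
    ring

/-! ### Coprimality -/

/-- The value at `z` of the polynomial with integer coefficients `l`. -/
def evalCoeffs {R : Type*} [CommRing R] (z : R) : List ℤ → R
  | [] => 0
  | c :: l => c + z * evalCoeffs z l

/-- Addition of polynomials given by coefficients. -/
def addCoeffs : List ℤ → List ℤ → List ℤ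
  | [], m => m
  | l, [] => l
  | c :: l, d :: m => (c + d) :: addCoeffs l m

/-- Multiplication of polynomials given by coefficients. -/
def mulCoeffs : List ℤ → List ℤ → List ℤ
  | [], _ => []
  | c :: l, m => addCoeffs (m.map (c * ·)) (0 :: mulCoeffs l m)

section EvalCoeffs

variable {R : Type*} [CommRing R] (z : R)

lemma evalCoeffs_add (l m : List ℤ) :
    evalCoeffs z (addCoeffs l m) = evalCoeffs z l + evalCoeffs z m := by
  induction l generalizing m with
  | nil => simp [addCoeffs, evalCoeffs]
  | cons c l ih =>
    cases m with
    | nil => simp [addCoeffs, evalCoeffs]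
    | cons d m =>
      simp only [addCoeffs, evalCoeffs, ih]
      push_cast
      ring

lemma evalCoeffs_map_mul (c : ℤ) (m : List ℤ) :
    evalCoeffs z (m.map (c * ·)) = c * evalCoeffs z m := by
  induction m with
  | nil => simp [evalCoeffs]
  | cons d m ih =>
    simp only [List.map_cons, evalCoeffs, ih]
    push_cast
    ring

lemma evalCoeffs_mul (l m : List ℤ) :
    evalCoeffs z (mulCoeffs l m) = evalCoeffs z l * evalCoeffs z m := by
  induction l with
  | nil => simp [mulCoeffs, evalCoeffs]
  | cons c l ih =>
    simp only [mulCoeffs, evalCoeffs_add, evalCoeffs_map_mul, evalCoeffs, ih]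
    push_cast
    ring

lemma aeval_ofCoeffs {K : Type*} [Field K] [Algebra ℚ K] (z : K) (l : List ℤ) :
    aeval z (ofCoeffs l) = evalCoeffs z l := by
  induction l with
  | nil => simp [ofCoeffs, evalCoeffs]
  | cons c l ih => simp [ofCoeffs, evalCoeffs, ih]

lemma isIntegral_evalCoeffs {z : R} (hz : IsIntegral ℤ z) (l : List ℤ) :
    IsIntegral ℤ (evalCoeffs z l) := by
  induction l with
  | nil => exact isIntegral_zero
  | cons c l ih => exact (isIntegral_algebraMap (R := ℤ) (x := c)).add (hz.mul ih)

lemma exists_evalCoeffs_append (l : List ℤ) :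
    ∃ p : ℤ[X], p.degree < l.length ∧ evalCoeffs z (l ++ [1]) = aeval z (X ^ l.length + p) := by
  induction l with
  | nil => exact ⟨0, by simp, by simp [evalCoeffs]⟩
  | cons c l ih =>
    obtain ⟨p, hp, h⟩ := ih
    refine ⟨X * p + C c, ?_, ?_⟩
    · refine (degree_add_le _ _).trans_lt (max_lt ?_ ?_)
      · rw [mul_comm, degree_mul_X, List.length_cons]
        push_cast
        rcases eq_or_ne p 0 with rfl | hp0
        · simp
        · rw [degree_eq_natDegree hp0] at hp ⊢
          norm_cast at hp ⊢
          omega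
      · refine degree_C_le.trans_lt ?_
        rw [List.length_cons]
        norm_cast
        omega
    · rw [List.cons_append, evalCoeffs, h]
      simp [pow_succ']
      ring

lemma isIntegral_of_evalCoeffs_eq_zero {z : R} (l : List ℤ) (h : evalCoeffs z (l ++ [1]) = 0) :
    IsIntegral ℤ z := by
  obtain ⟨p, hp, hpz⟩ := exists_evalCoeffs_append z l
  exact ⟨X ^ l.length + p, monic_X_pow_add hp, by rw [← aeval_def, ← hpz, h]⟩

end EvalCoeffs

/-- Coprimality from a Bézout identity modulo an integer, for a monic second polynomial. -/
lemma isCoprime_ofCoeffs (l m a b c : List ℤ) {q : ℤ} (hq : ¬ IsUnit q) (hq0 : q ≠ 0)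
    (h : addCoeffs (mulCoeffs a l) (mulCoeffs b (m ++ [1])) = addCoeffs [1] (c.map (q * ·))) :
    IsCoprime (ofCoeffs l) (ofCoeffs (m ++ [1])) := by
  rw [isCoprime_iff_aeval_ne_zero_of_isAlgClosed ℚ (AlgebraicClosure ℚ)]
  intro z
  by_contra! hz
  obtain ⟨h1, h2⟩ := hz
  rw [aeval_ofCoeffs] at h1 h2
  have hint := isIntegral_evalCoeffs (isIntegral_of_evalCoeffs_eq_zero m h2) c
  have h3 := congrArg (evalCoeffs z) h
  rw [evalCoeffs_add, evalCoeffs_add, evalCoeffs_mul, evalCoeffs_mul, h1, h2,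
    evalCoeffs_map_mul] at h3
  simp only [evalCoeffs, mul_zero, add_zero, Int.cast_one] at h3
  have hq' : (q : ℚ) ≠ 0 := by exact_mod_cast hq0
  -- At a common root `z` the identity reads `0 = 1 + q * c(z)`. As a root of a monic integer
  -- polynomial `z` is integral, hence so is the rational number `-1/q`, which forces `q` to be a
  -- unit.
  have h4 : evalCoeffs z c = algebraMap ℚ (AlgebraicClosure ℚ) (-(1 / q)) := by
    have : (q : AlgebraicClosure ℚ) ≠ 0 := by exact_mod_cast hq0
    rw [map_neg, map_div₀, map_one, map_intCast]
    field_simp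
    linear_combination -h3
  rw [h4, isIntegral_algebraMap_iff (algebraMap ℚ (AlgebraicClosure ℚ)).injective] at hint
  obtain ⟨y, hy⟩ := IsIntegrallyClosed.isIntegral_iff.1 hint
  refine hq (IsUnit.of_mul_eq_one (-y) ?_)
  have : (y : ℚ) = -(1 / q) := hy
  have h5 : (q : ℚ) * -y = 1 := by rw [this]; field_simp
  exact_mod_cast h5

/-- The cofactor of the numerator in a Bézout identity modulo `3`, for `k = 7`. -/
def bezoutNumSeven : List ℤ :=
  [0, 2, 2, 2, 1, 2, 1, 2, 1, 1, 1, 2, 2, 0, 1, 2, 1, 2, 0, 2, 0, 1, 1, 2, 2, 1, 1, 0, 2, 2, 2, 1,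
  1, 0, 1, 2, 0, 0, 1, 1, 0, 2, 0, 1, 2, 2, 2, 2]

/-- The cofactor of the denominator in a Bézout identity modulo `3`, for `k = 7`. -/
def bezoutDenSeven : List ℤ :=
  [1, 0, 0, 1, 0, 0, 1, 1, 2, 0, 2, 2, 1, 2, 0, 2, 0, 2, 0, 0, 1, 1, 2, 2, 0, 2, 1, 1, 0, 2, 1, 0,
  1, 2, 1, 0, 2, 0, 2, 1, 0, 2, 0, 0, 2, 1, 2]

/-- The only spanning tree of a path is the path. -/
lemma numSpanningTrees_one (n : ℕ) : numSpanningTrees 1 (n + 1) = 1 := by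
  have h := numSpanningTrees_eq_det (ι := Fin 0) (k := 1) one_pos (Equiv.sumEmpty _ _) 1 (by simp)
    0 (by simp) (by decide +kernel) (by decide +kernel) n
  rw [det_isEmpty] at h
  exact_mod_cast h

theorem gridGF_one : gridGF 1 = ratSeries gridNum1 gridDen1 := by
  -- The padding zero in `den` makes the recurrence start after `s(1, 0) = 0`, where the sequence
  -- becomes constant, and gives room for the degree one numerator.
  refine gridGF_eq_ratSeries (num := [0, 1]) (den := [-1, 0]) (t := fun n => n)
    (by simp [gridNum1, ofCoeffs]) ?_ (fun _ => rfl) (fun n => ?_) (fun n hn => ?_) (by decide)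
    (by decide)
  · simp [gridDen1, ofCoeffs]
    ring
  · simp [lincomb, numSpanningTrees_one]
  · rcases n with _ | _ | n
    · simp [numSpanningTrees_zero]
    · simp [numSpanningTrees_one]
    · simp at hn

lemma gridNum7_eq : gridNum7 = ofCoeffs numCoeffsSeven := by
  simp only [gridNum7, ofCoeffs, numCoeffsSeven]
  push_cast
  ring

lemma gridDen7_eq : gridDen7 = ofCoeffs (1 :: denCoeffsSeven) := by
  simp only [gridDen7, ofCoeffs, denCoeffsSeven]
  push_cast
  ring

lemma isCoprime_gridNum7_gridDen7 : IsCoprime gridNum7 gridDen7 := by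
  have h : 1 :: denCoeffsSeven = (1 :: denCoeffsSeven).dropLast ++ [1] := by decide +kernel
  rw [gridNum7_eq, gridDen7_eq, h]
  -- The cofactor of `3` is the Bézout combination minus `1`, divided by `3`; the final check
  -- confirms that the division is exact.
  exact isCoprime_ofCoeffs _ _ bezoutNumSeven bezoutDenSeven
    ((addCoeffs (addCoeffs (mulCoeffs bezoutNumSeven numCoeffsSeven)
      (mulCoeffs bezoutDenSeven (1 :: denCoeffsSeven))) [-1]).map (· / 3)) (q := 3)
    (by decide) (by decide) (by decide +kernel)

set_option maxRecDepth 4000 in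
lemma natDegree_gridDen7 : gridDen7.natDegree = 48 := by
  unfold gridDen7
  compute_degree!

theorem mainTheorem2 :
    gridGF 1 = ratSeries gridNum1 gridDen1 ∧
    gridGF 2 = ratSeries gridNum2 gridDen2 ∧
    gridGF 3 = ratSeries gridNum3 gridDen3 ∧
    gridGF 4 = ratSeries gridNum4 gridDen4 ∧
    gridGF 5 = ratSeries gridNum5 gridDen5 ∧
    gridGF 6 = ratSeries gridNum6 gridDen6 ∧
    gridGF 7 = ratSeries gridNum7 gridDen7 ∧
    gridDen7.natDegree = 48 ∧ IsCoprime gridNum7 gridDen7 := by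
  exact ⟨gridGF_one, gridGF_two, gridGF_three, gridGF_four, gridGF_five, gridGF_six, gridGF_seven,
    natDegree_gridDen7, isCoprime_gridNum7_gridDen7⟩
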